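/- Setting. Let $X$ be a complete metric space with a Borel measure $\mu$, let $\Omega\subset X$ be a bounded domain (nonempty, open, connected), and let $\mathcal H$ be a $\sigma$-finite Borel measure on $\partial\Omega$. Let $1<p<\infty$ and $0<\theta<p$, and let $\Omega$ be weakly $(p,\theta)$-admissible, that is: (i) there is $C_d\ge 1$ with $0<\mu(B(x,2r)\cap\Omega)\le C_d\,\mu(B(x,r)\cap\Omega)<\infty$ for all $x\in\overline\Omega$, $r>0$; (ii) there is $C$ with $\mathcal H(B(x,r)\cap\partial\Omega)\le C\,r^{-\theta}\mu(B(x,r)\cap\Omega)$ for all $x\in\partial\Omega$ and $0<r\le 2\operatorname{diam}\Omega$; (iii) there are $C>0$, $\lambda\ge 1$ such that for all $x\in\Omega$, $r>0$, all $u\in L^1_{\rm loc}(\Omega)$ (real-valued) and all upper gradients $g$ of $u$ in $\Omega$, $$\frac{1}{\mu(B)}\int_{B}|u-u_{B}|\,d\mu\le C r\Big(\frac{1}{\mu(\lambda B)}\int_{\lambda B}g^p\,d\mu\Big)^{1/p},\qquad B=B(x,r)\cap\Omega,\ \ \lambda B=B(x,\lambda r)\cap\Omega,$$ where $u_B$ is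 the $\mu$-average of $u$ over $B$. For a metric space $Y$, $L^p(\Omega,Y)$ consists of the $\mu$-measurable, essentially separably valued maps $u:\Omega\to Y$ with $d_Y(u,y_0)\in L^p(\Omega)$ for some $y_0\in Y$ (similarly for $L^p(\partial\Omega,Y)$ with $\mathcal H$), and $N^{1,p}(\Omega,Y)$ of those $u\in L^p(\Omega,Y)$ that have a $p$-weak upper gradient in $L^p(\Omega)$; put $\|u\|_{D^{1,p}}=\inf_g\|g\|_{L^p(\Omega)}$ over all $p$-weak upper gradients $g$ of $u$. For a Banach space $V$, $N^{1,p}(\Omega,V)$ is normed by $\|u\|_{L^p(\Omega,V)}+\|u\|_{D^{1,p}}$, after identification of maps at distance $0$. A point $y\in Y$ is the trace of $u$ at $z\in\partial\Omega$ if $\frac{1}{\mu(B(z,r)\cap\Omega)}\int_{B(z,r)\cap\Omega}d_Y(u,y)\,d\mu\to0$ as $r\to0^+$; it is then denoted by $Tu(z)$. Theorem. (a) Let $V$ be a (real) Banach space. Every $u\in N^{1,p}(\Omega,V)$ has a trace $Tu(z)$ at $\mathcal H$-a.e. $z\in\partial\Omega$, and $u\mapsto Tu$ is a well-defined bounded linear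 operator $T:N^{1,p}(\Omega,V)\to L^p(\partial\Omega,V)$. Moreover, with $R=2\operatorname{diam}\Omega$, for $\mathcal H$-a.e. $z\in\partial\Omega$, $$Tu(z)=\lim_{k\to\infty}\frac{1}{\mu(B(z,2^{-k}R)\cap\Omega)}\int_{B(z,2^{-k}R)\cap\Omega}u\,d\mu .$$ (b) Let $Y$ be a complete metric space and $h:Y\to V$ an isometric embedding into a Banach space $V$. For every $u\in N^{1,p}(\Omega,Y)$ one has $h\circ u\in N^{1,p}(\Omega,V)$, the trace $Tu(z)\in Y$ exists at $\mathcal H$-a.e. $z\in\partial\Omega$, $Tu\in L^p(\partial\Omega,Y)$, and $h\circ Tu=T(h\circ u)$ $\mathcal H$-a.e., with the bounded linear operator $T$ of (a) on the right. Moreover there is a constant $C$, independent of $Y$, $h$, $u$ and $y_0$, with $$\|d_Y(Tu,y_0)\|_{L^p(\partial\Omega)}\le C\big(\|d_Y(u,y_0)\|_{L^p(\Omega)}+\|u\|_{D^{1,p}}\big)\qquad\text{for all }y_0\in Y.$$ -/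

import Mathlib

open Set Filter Topology MeasureTheory
open scoped ENNReal NNReal

noncomputable section

namespace MetricTrace

/-! ### Rectifiable curves, line integrals, modulus -/

/-- A rectifiable curve `γ : [a, b] → Ω`: continuous, of finite length, with values in `Ω`.
(Only the values of `toFun` on `[a, b]` are relevant.) -/
structure RectCurve {X : Type*} [MetricSpace X] (Ω : Set X) where
  a : ℝ
  b : ℝ
  le : a ≤ b
  toFun : ℝ → X
  continuousOn : ContinuousOn toFun (Icc a b)
  mapsTo : MapsTo toFun (Icc a b) Ω
  finite_length : BoundedVariationOn toFun (Icc a b)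

/-- The length of a rectifiable curve. -/
def RectCurve.length {X : Type*} [MetricSpace X] {Ω : Set X} (γ : RectCurve Ω) : ℝ :=
  (eVariationOn γ.toFun (Icc γ.a γ.b)).toReal

/-- The line integral `∫_γ g ds`, i.e. the integral over `[0, length γ]` of `g` along the
arc-length parametrization of `γ`. -/
def RectCurve.lineIntegral {X : Type*} [MetricSpace X] {Ω : Set X} (γ : RectCurve Ω)
    (g : X → ℝ≥0∞) : ℝ≥0∞ :=
  ∫⁻ t in Icc 0 γ.length, g (naturalParameterization γ.toFun (Icc γ.a γ.b) γ.a t)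

/-- The `L^p`-norm over `Ω` of a `[0, ∞]`-valued function. -/
def lpNorm {X : Type*} [MeasurableSpace X] (Ω : Set X) (μ : Measure X) (p : ℝ)
    (g : X → ℝ≥0∞) : ℝ≥0∞ :=
  (∫⁻ x in Ω, g x ^ p ∂μ) ^ (1 / p)

/-- The `p`-modulus of a family of rectifiable curves in `Ω`. -/
def modulus {X : Type*} [MetricSpace X] [MeasurableSpace X] (Ω : Set X) (μ : Measure X) (p : ℝ)
    (Γ : Set (RectCurve Ω)) : ℝ≥0∞ :=
  ⨅ (ρ : X → ℝ≥0∞) (_ : Measurable ρ) (_ : ∀ γ ∈ Γ, 1 ≤ γ.lineIntegral ρ),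
    ∫⁻ x in Ω, ρ x ^ p ∂μ

/-! ### Upper gradients -/

/-- The upper gradient inequality for the pair `(u, g)` on the curve `γ`. -/
def UpperGradientIneq {X Z : Type*} [MetricSpace X] [PseudoEMetricSpace Z] {Ω : Set X}
    (g : X → ℝ≥0∞) (u : X → Z) (γ : RectCurve Ω) : Prop :=
  edist (u (γ.toFun γ.b)) (u (γ.toFun γ.a)) ≤ γ.lineIntegral g

/-- `g` is an upper gradient of `u` on `Ω`. (Maps and functions on `Ω` are represented by maps
on `X` whose values outside `Ω` are irrelevant; for an open `Ω`, a Borel function on `Ω` is the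
restriction of a Borel function on `X`.) -/
def IsUpperGradient {X Z : Type*} [MetricSpace X] [MeasurableSpace X] [PseudoEMetricSpace Z]
    (Ω : Set X) (g : X → ℝ≥0∞) (u : X → Z) : Prop :=
  Measurable g ∧ ∀ γ : RectCurve Ω, UpperGradientIneq g u γ

/-- `g` is a `p`-weak upper gradient of `u` on `Ω`: the upper gradient inequality holds for all
rectifiable curves in `Ω` outside a family of `p`-modulus zero. -/
def IsWeakUpperGradient {X Z : Type*} [MetricSpace X] [MeasurableSpace X] [PseudoEMetricSpace Z]
    (Ω : Set X) (μ : Measure X) (p : ℝ) (g : X → ℝ≥0∞) (u : X → Z) : Prop :=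
  Measurable g ∧ modulus Ω μ p {γ : RectCurve Ω | ¬ UpperGradientIneq g u γ} = 0

/-- The Dirichlet seminorm: the infimum of `‖g‖_{L^p(Ω)}` over all `p`-weak upper gradients `g`
of `u`. It is the `L^p`-norm of the minimal `p`-weak upper gradient whenever it is finite. -/
def gradNorm {X Z : Type*} [MetricSpace X] [MeasurableSpace X] [PseudoEMetricSpace Z]
    (Ω : Set X) (μ : Measure X) (p : ℝ) (u : X → Z) : ℝ≥0∞ :=
  ⨅ (g : X → ℝ≥0∞) (_ : IsWeakUpperGradient Ω μ p g u), lpNorm Ω μ p g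

/-! ### Metric-valued `L^p` and Sobolev maps -/

/-- `u ∈ L^p(S, Y)`: `u` is `ν`-measurable and essentially separably valued on `S`, and
`d(u, y₀) ∈ L^p(S)` for some `y₀`. -/
def MemLpMetric {X Y : Type*} [MeasurableSpace X] [MetricSpace Y]
    (S : Set X) (ν : Measure X) (p : ℝ) (u : X → Y) : Prop :=
  AEStronglyMeasurable u (ν.restrict S) ∧
    ∃ y₀ : Y, MemLp (fun x => dist (u x) y₀) (ENNReal.ofReal p) (ν.restrict S)

/-- `u ∈ N^{1,p}(Ω, Y)` for a metric space `Y`. -/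
def MemNewton {X Y : Type*} [MetricSpace X] [MeasurableSpace X] [MetricSpace Y]
    (Ω : Set X) (μ : Measure X) (p : ℝ) (u : X → Y) : Prop :=
  MemLpMetric Ω μ p u ∧ gradNorm Ω μ p u < ∞

/-! ### The trace -/

/-- `y` is the trace of `u` at `z`: the averages of `d(u, y)` over `B(z, r) ∩ Ω` tend to `0`. -/
def IsTraceAt {X Y : Type*} [MetricSpace X] [MeasurableSpace X] [MetricSpace Y]
    (Ω : Set X) (μ : Measure X) (u : X → Y) (z : X) (y : Y) : Prop :=
  Tendsto (fun r : ℝ => ⨍⁻ x in Metric.ball z r ∩ Ω, edist (u x) y ∂μ) (𝓝[>] 0) (𝓝 0)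

/-! ### Weakly admissible domains -/

/-- `μ` is a doubling measure on `Ω`. -/
def DoublingOn {X : Type*} [MetricSpace X] [MeasurableSpace X] (Ω : Set X) (μ : Measure X) :
    Prop :=
  ∃ C : ℝ≥0, 1 ≤ C ∧ ∀ x ∈ closure Ω, ∀ r : ℝ, 0 < r →
    0 < μ (Metric.ball x (2 * r) ∩ Ω) ∧
    μ (Metric.ball x (2 * r) ∩ Ω) ≤ C * μ (Metric.ball x r ∩ Ω) ∧
    μ (Metric.ball x r ∩ Ω) < ∞

/-- `H` is upper codimension-`θ` regular on `F`, at all scales `0 < r ≤ 2 diam Ω`. -/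
def UpperCodimRegular {X : Type*} [MetricSpace X] [MeasurableSpace X] (Ω : Set X)
    (μ : Measure X) (F : Set X) (H : Measure X) (θ : ℝ) : Prop :=
  ∃ C : ℝ≥0, ∀ x ∈ F, ∀ r : ℝ, 0 < r → r ≤ 2 * Metric.diam Ω →
    H (Metric.ball x r ∩ F) ≤ C * (μ (Metric.ball x r ∩ Ω) / ENNReal.ofReal (r ^ θ))

/-- `Ω` supports a local `q`-Poincaré inequality (for real-valued functions). -/
def LocalPoincare {X : Type*} [MetricSpace X] [MeasurableSpace X] (Ω : Set X) (μ : Measure X)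
    (q : ℝ) : Prop :=
  ∃ C lam : ℝ, 0 < C ∧ 1 ≤ lam ∧ ∀ x ∈ Ω, ∀ r : ℝ, 0 < r →
    ∀ u : X → ℝ, LocallyIntegrableOn u Ω μ →
    ∀ g : X → ℝ≥0∞, IsUpperGradient Ω g u →
      ⨍⁻ y in Metric.ball x r ∩ Ω, ‖u y - ⨍ w in Metric.ball x r ∩ Ω, u w ∂μ‖ₑ ∂μ ≤
        ENNReal.ofReal (C * r) *
          (⨍⁻ y in Metric.ball x (lam * r) ∩ Ω, g y ^ q ∂μ) ^ (1 / q)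

/-- `Ω` is weakly `(q, θ)`-admissible with respect to the measure `μ` on `Ω` and the measure `H`
on `∂Ω`. -/
structure WeaklyAdmissible {X : Type*} [MetricSpace X] [MeasurableSpace X] (Ω : Set X)
    (μ H : Measure X) (q θ : ℝ) : Prop where
  one_lt : 1 < q
  pos : 0 < θ
  lt : θ < q
  doubling : DoublingOn Ω μ
  upperCodim : UpperCodimRegular Ω μ (frontier Ω) H θ
  poincare : LocalPoincare Ω μ q

/-! ### The Banach-valued Sobolev space `N^{1,p}(Ω, V)` as a normed space -/

section Lemmas

variable {X : Type*} [MetricSpace X] {Ω : Set X}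

theorem RectCurve.lineIntegral_add_le (γ : RectCurve Ω) (g h : X → ℝ≥0∞) :
    γ.lineIntegral g + γ.lineIntegral h ≤ γ.lineIntegral (g + h) :=
  le_lintegral_add _ _

theorem RectCurve.lineIntegral_mul_le (γ : RectCurve Ω) (c : ℝ≥0∞) (g : X → ℝ≥0∞) :
    c * γ.lineIntegral g ≤ γ.lineIntegral (fun x => c * g x) :=
  lintegral_const_mul_le _ _

theorem RectCurve.lineIntegral_mono (γ : RectCurve Ω) {g h : X → ℝ≥0∞} (hgh : g ≤ h) :
    γ.lineIntegral g ≤ γ.lineIntegral h :=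
  lintegral_mono fun _ => hgh _

variable [MeasurableSpace X] {μ : Measure X} {p : ℝ}

theorem modulus_mono {Γ Γ' : Set (RectCurve Ω)} (h : Γ ⊆ Γ') :
    modulus Ω μ p Γ ≤ modulus Ω μ p Γ' :=
  le_iInf fun ρ => le_iInf fun hρ => le_iInf fun hρ' =>
    iInf_le_of_le ρ (iInf_le_of_le hρ (iInf_le_of_le (fun γ hγ => hρ' γ (h hγ)) le_rfl))

theorem modulus_union_le (Γ Γ' : Set (RectCurve Ω)) :
    modulus Ω μ p (Γ ∪ Γ') ≤ modulus Ω μ p Γ + modulus Ω μ p Γ' := by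
  have key : ∀ ρ σ : X → ℝ≥0∞, Measurable ρ → Measurable σ → (∀ γ ∈ Γ, 1 ≤ γ.lineIntegral ρ) →
      (∀ γ ∈ Γ', 1 ≤ γ.lineIntegral σ) →
      modulus Ω μ p (Γ ∪ Γ') ≤ (∫⁻ x in Ω, ρ x ^ p ∂μ) + ∫⁻ x in Ω, σ x ^ p ∂μ := by
    intro ρ σ hρ hσ hρ' hσ'
    refine iInf_le_of_le (ρ ⊔ σ) (iInf_le_of_le (hρ.sup hσ) (iInf_le_of_le ?_ ?_))
    · rintro γ (hγ | hγ)
      · exact (hρ' γ hγ).trans (γ.lineIntegral_mono le_sup_left)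
      · exact (hσ' γ hγ).trans (γ.lineIntegral_mono le_sup_right)
    · rw [← lintegral_add_left (hρ.pow_const p)]
      refine lintegral_mono fun x => ?_
      rcases le_total (ρ x) (σ x) with hx | hx
      · simp [Pi.sup_apply, sup_eq_right.2 hx]
      · simp [Pi.sup_apply, sup_eq_left.2 hx]
  rw [modulus.eq_def Ω μ p Γ, modulus.eq_def Ω μ p Γ']
  simp only [ENNReal.iInf_add, ENNReal.add_iInf]
  exact le_iInf fun σ => le_iInf fun hσ => le_iInf fun hσ' => le_iInf fun ρ => le_iInf fun hρ =>
    le_iInf fun hρ' => key ρ σ hρ hσ hρ' hσ'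

theorem lpNorm_add_le (hp : 1 ≤ p) {g h : X → ℝ≥0∞} (hg : Measurable g) (hh : Measurable h) :
    lpNorm Ω μ p (g + h) ≤ lpNorm Ω μ p g + lpNorm Ω μ p h :=
  ENNReal.lintegral_Lp_add_le hg.aemeasurable hh.aemeasurable hp

theorem lpNorm_mul (hp : 0 < p) (c : ℝ≥0∞) {g : X → ℝ≥0∞} (hg : Measurable g) :
    lpNorm Ω μ p (fun x => c * g x) = c * lpNorm Ω μ p g := by
  simp only [lpNorm, ENNReal.mul_rpow_of_nonneg _ _ hp.le]
  rw [lintegral_const_mul _ (hg.pow_const p), ENNReal.mul_rpow_of_nonneg _ _ (by positivity),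
    ← ENNReal.rpow_mul, mul_one_div_cancel hp.ne', ENNReal.rpow_one]

variable {V : Type*} [NormedAddCommGroup V] [NormedSpace ℝ V]

theorem IsWeakUpperGradient.add {g h : X → ℝ≥0∞} {u v : X → V}
    (hg : IsWeakUpperGradient Ω μ p g u) (hh : IsWeakUpperGradient Ω μ p h v) :
    IsWeakUpperGradient Ω μ p (g + h) (u + v) := by
  refine ⟨hg.1.add hh.1, le_antisymm ?_ zero_le⟩
  suffices hsub : {γ : RectCurve Ω | ¬ UpperGradientIneq (g + h) (u + v) γ} ⊆
      {γ : RectCurve Ω | ¬ UpperGradientIneq g u γ} ∪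
        {γ : RectCurve Ω | ¬ UpperGradientIneq h v γ} from
    ((modulus_mono hsub).trans (modulus_union_le _ _)).trans
      (by rw [hg.2, hh.2, add_zero])
  intro γ hγ
  by_contra hcon
  simp only [mem_union, mem_ofPred_eq, not_or, not_not] at hcon
  exact hγ <| (edist_add_add_le _ _ _ _).trans <|
    (add_le_add hcon.1 hcon.2).trans (γ.lineIntegral_add_le g h)

theorem IsWeakUpperGradient.smul (c : ℝ) {g : X → ℝ≥0∞} {u : X → V}
    (hg : IsWeakUpperGradient Ω μ p g u) :
    IsWeakUpperGradient Ω μ p (fun x => ‖c‖ₑ * g x) (c • u) := by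
  refine ⟨hg.1.const_mul _, le_antisymm ((modulus_mono ?_).trans hg.2.le) zero_le⟩
  intro γ hγ hcon
  refine hγ (le_trans ?_ ((mul_le_mul_right hcon ‖c‖ₑ).trans (γ.lineIntegral_mul_le _ g)))
  simp only [Pi.smul_apply, edist_smul₀]
  rfl

theorem isWeakUpperGradient_zero (hp : 0 < p) :
    IsWeakUpperGradient Ω μ p (0 : X → ℝ≥0∞) (0 : X → V) := by
  refine ⟨measurable_zero, le_antisymm ?_ zero_le⟩
  refine iInf_le_of_le 0 (iInf_le_of_le measurable_zero (iInf_le_of_le ?_ ?_))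
  · intro γ hγ
    exact absurd (by simp [UpperGradientIneq]) hγ
  · simp [hp]

theorem gradNorm_zero (hp : 0 < p) : gradNorm Ω μ p (0 : X → V) = 0 := by
  refine le_antisymm (iInf_le_of_le 0 (iInf_le_of_le (isWeakUpperGradient_zero hp) ?_)) zero_le
  simp [lpNorm, hp]

theorem gradNorm_add_le (hp : 1 ≤ p) (u v : X → V) :
    gradNorm Ω μ p (u + v) ≤ gradNorm Ω μ p u + gradNorm Ω μ p v := by
  rw [gradNorm.eq_def Ω μ p u, gradNorm.eq_def Ω μ p v, iInf_subtype', iInf_subtype']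
  refine ENNReal.le_iInf_add_iInf fun g h => ?_
  exact iInf_le_of_le (g.1 + h.1) <| iInf_le_of_le (g.2.add h.2)
      (lpNorm_add_le hp g.2.1 h.2.1)

theorem gradNorm_smul_le (hp : 0 < p) (c : ℝ) (u : X → V) :
    gradNorm Ω μ p (c • u) ≤ ‖c‖ₑ * gradNorm Ω μ p u := by
  rcases eq_or_ne c 0 with rfl | hc
  · rw [zero_smul, gradNorm_zero hp]
    exact zero_le
  have h0 : ‖c‖ₑ ≠ 0 := by simpa using hc
  conv_rhs => simp only [gradNorm, ENNReal.mul_iInf_of_ne h0 enorm_ne_top]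
  exact le_iInf fun g => le_iInf fun hg =>
    iInf_le_of_le _ <| iInf_le_of_le (hg.smul c) (lpNorm_mul hp _ hg.1).le

end Lemmas

section Newton

variable {X : Type*} [MetricSpace X] [MeasurableSpace X] (Ω : Set X) (μ : Measure X) (p : ℝ)
  (V : Type*) [NormedAddCommGroup V] [NormedSpace ℝ V]

instance fact_one_le_ofReal {p : ℝ} [h : Fact (1 < p)] : Fact (1 ≤ ENNReal.ofReal p) :=
  ⟨ENNReal.one_le_ofReal.2 h.out.le⟩

/-- The vector space `Ñ^{1,p}(Ω, V)` of all `u ∈ L^p(Ω, V)` with a `p`-weak upper gradient in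
`L^p(Ω)`. -/
def newtonSubmodule [Fact (1 < p)] : Submodule ℝ (X → V) where
  carrier := {u | MemLp u (ENNReal.ofReal p) (μ.restrict Ω) ∧ gradNorm Ω μ p u < ∞}
  add_mem' {u v} hu hv := ⟨hu.1.add hv.1,
    (gradNorm_add_le (Fact.out : 1 < p).le u v).trans_lt (ENNReal.add_lt_top.2 ⟨hu.2, hv.2⟩)⟩
  zero_mem' := ⟨MemLp.zero, by
    rw [gradNorm_zero (zero_lt_one.trans (Fact.out : 1 < p))]; exact ENNReal.zero_lt_top⟩
  smul_mem' c u hu := ⟨hu.1.const_smul c,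
    (gradNorm_smul_le (zero_lt_one.trans (Fact.out : 1 < p)) c u).trans_lt
      (ENNReal.mul_lt_top enorm_lt_top hu.2)⟩

/-- `Ñ^{1,p}(Ω, V)`, as a type that carries the topology of its seminorm (below). -/
def PreNewton [Fact (1 < p)] : Type _ := newtonSubmodule Ω μ p V

variable [Fact (1 < p)]

instance : AddCommGroup (PreNewton Ω μ p V) :=
  inferInstanceAs (AddCommGroup (newtonSubmodule Ω μ p V))

instance : Module ℝ (PreNewton Ω μ p V) :=
  inferInstanceAs (Module ℝ (newtonSubmodule Ω μ p V))

variable {Ω μ p V}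

/-- The map `X → V` that underlies an element of `Ñ^{1,p}(Ω, V)`. -/
def PreNewton.toFun (u : PreNewton Ω μ p V) : X → V := Subtype.val u

/-- The seminorm `‖u‖_{L^p(Ω, V)} + inf_g ‖g‖_{L^p(Ω)}` of `Ñ^{1,p}(Ω, V)`. -/
def PreNewton.seminorm : AddGroupSeminorm (PreNewton Ω μ p V) where
  toFun u := (eLpNorm u.toFun (ENNReal.ofReal p) (μ.restrict Ω)).toReal +
    (gradNorm Ω μ p u.toFun).toReal
  map_zero' := by
    have h : (0 : PreNewton Ω μ p V).toFun = 0 := rfl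
    rw [h, gradNorm_zero (zero_lt_one.trans (Fact.out : 1 < p))]
    simp
  add_le' u v := by
    have h : (u + v).toFun = u.toFun + v.toFun := rfl
    have h1 := ENNReal.toReal_mono (ENNReal.add_ne_top.2 ⟨u.2.1.2.ne, v.2.1.2.ne⟩)
      (eLpNorm_add_le u.2.1.1 v.2.1.1 (Fact.out : 1 ≤ ENNReal.ofReal p))
    have h2 := ENNReal.toReal_mono (ENNReal.add_ne_top.2 ⟨u.2.2.ne, v.2.2.ne⟩)
      (gradNorm_add_le (Ω := Ω) (μ := μ) (Fact.out : 1 < p).le u.1 v.1)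
    rw [ENNReal.toReal_add u.2.1.2.ne v.2.1.2.ne] at h1
    rw [ENNReal.toReal_add u.2.2.ne v.2.2.ne] at h2
    rw [h]
    unfold PreNewton.toFun
    linarith
  neg' u := by
    have hp : 0 < p := zero_lt_one.trans (Fact.out : 1 < p)
    have h : (-u).toFun = -u.toFun := rfl
    have key : ∀ w : X → V, gradNorm Ω μ p (-w) ≤ gradNorm Ω μ p w := fun w => by
      simpa using gradNorm_smul_le (Ω := Ω) (μ := μ) hp (-1) w
    rw [h, eLpNorm_neg, le_antisymm (key u.toFun) (by simpa using key (-u.toFun))]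

instance : SeminormedAddCommGroup (PreNewton Ω μ p V) :=
  PreNewton.seminorm.toSeminormedAddCommGroup

theorem PreNewton.norm_def (u : PreNewton Ω μ p V) :
    ‖u‖ = (eLpNorm u.toFun (ENNReal.ofReal p) (μ.restrict Ω)).toReal +
      (gradNorm Ω μ p u.toFun).toReal :=
  rfl

instance : NormedSpace ℝ (PreNewton Ω μ p V) where
  norm_smul_le c u := by
    have hp : 0 < p := zero_lt_one.trans (Fact.out : 1 < p)
    have h : (c • u).toFun = c • u.toFun := rfl
    have h1 := ENNReal.toReal_mono (ENNReal.mul_ne_top enorm_ne_top u.2.2.ne)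
      (gradNorm_smul_le (Ω := Ω) (μ := μ) hp c u.1)
    rw [ENNReal.toReal_mul, toReal_enorm] at h1
    rw [PreNewton.norm_def, PreNewton.norm_def, h, eLpNorm_const_smul, ENNReal.toReal_mul,
      toReal_enorm, mul_add]
    exact add_le_add le_rfl h1

variable (Ω μ p V)

/-- The Sobolev space `N^{1,p}(Ω, V)`: the normed space of equivalence classes of elements of
`Ñ^{1,p}(Ω, V)`, where `u₁ ∼ u₂` if and only if `‖u₁ - u₂‖ = 0`. -/
abbrev Newton : Type _ := SeparationQuotient (PreNewton Ω μ p V)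

variable {Ω μ p V}

/-- The class in `N^{1,p}(Ω, V)` of a map `u ∈ Ñ^{1,p}(Ω, V)`. -/
def Newton.mk (u : X → V) (hu : u ∈ newtonSubmodule Ω μ p V) : Newton Ω μ p V :=
  SeparationQuotient.mk (⟨u, hu⟩ : newtonSubmodule Ω μ p V)

end Newton

end MetricTrace

end

open MetricTrace

/-!
Traces of Sobolev maps on weakly admissible domains.

Write `ν` for the restriction of `μ` to `Ω`, and `r_k = 2⁻ᵏ (2 diam Ω)`. Everything rests on a
Poincaré inequality for Banach-valued maps on balls centred at the boundary, which is then summed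
over the scales `r_k`.

*Banach-valued Poincaré inequality.* The hypothesis concerns real functions only. Applied to
`l ∘ u`, with `l` a norming functional of the difference of two means of `u`, it bounds the
difference of the means of `u` over nested balls of comparable radii
(`exists_nestedMeanBound`). The mean oscillation of `u` over `B(z, r)` follows by chaining: almost
every `u x` is joined to the mean over `B(z, r)` through the means over `B(x, 2⁻ʲ 2r)`. One
integrates the chain over `x` in `B(z, r)`, and by doubling averaging twice is no worse than
averaging once over a larger ball, so that no maximal function and no exponent is lost
(`exists_poincare_of_nestedMeanBound`). The chain ends at `u x` because averages over small balls
converge in `L¹` (`exists_lintegral_setAverage_sub_le`); by doubling and completeness the closure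
of `Ω` is compact, which makes the approximating continuous maps uniformly continuous, and makes
the averages measurable in their centre although `X` need not be separable.

*Boundary.* At `z ∈ ∂Ω` consecutive means over `B(z, r_k)` differ by at most a constant times
`r_k (⨍_{B(z, Λ r_k)} g ^ p)^{1/p}`. By Tonelli and the codimension bound, the integral over `∂Ω`
of the mean of `g ^ p` over `B(z, Λ r)` is at most `C r^{-θ} ∫ g ^ p`
(`exists_lintegral_frontier_setLAverage_le`), so the `L^p(∂Ω)`-norms of these terms decay like
`r_k^{1 - θ/p}`, and Minkowski's inequality bounds their sum by the norm of `g`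
(`exists_lpNorm_tsum_frontier_le`). Where the sum is finite the means converge and the limit is
the trace (`exists_trace_of_tsum_ne_top`); weak upper gradients are replaced by upper gradients of
almost the same norm (`exists_isUpperGradient_of_gradNorm_lt`).

*Metric targets.* An isometric embedding `h` of `Y` preserves the upper gradient inequality, and
the trace of `h ∘ u` lies in the closed set `h(Y)`. The estimate about `y₀` is the bound for `T`
applied to the embedding `h - h y₀`.
-/

/-! ### Doubling measures -/

/-- `ν` gives positive measure to balls centred on `K` and is doubling there with constant `D`.
In the application `ν` is the restriction of the measure to `Ω`, and `K` is the closure of `Ω`. -/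
structure DoublingAt {X : Type*} [MetricSpace X] [MeasurableSpace X] (K : Set X) (ν : Measure X)
    (D : ℝ≥0) : Prop where
  one_le : 1 ≤ D
  pos : ∀ x ∈ K, ∀ r : ℝ, 0 < r → 0 < ν (Metric.ball x r)
  le : ∀ x ∈ K, ∀ r : ℝ, 0 < r → ν (Metric.ball x (2 * r)) ≤ D * ν (Metric.ball x r)

section Doubling

variable {X : Type*} [MetricSpace X] [MeasurableSpace X] {K : Set X} {ν : Measure X} {D : ℝ≥0}

theorem DoublingAt.measure_ball_le (h : DoublingAt K ν D) {x : X} (hx : x ∈ K) {r s : ℝ}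
    (hr : 0 < r) (n : ℕ) (hs : s ≤ 2 ^ n * r) :
    ν (Metric.ball x s) ≤ (D : ℝ≥0∞) ^ n * ν (Metric.ball x r) := by
  refine (measure_mono (Metric.ball_subset_ball hs)).trans ?_
  clear hs
  induction n with
  | zero => simp
  | succ n ih =>
    have h1 := h.le x hx (2 ^ n * r) (by positivity)
    rw [pow_succ', pow_succ', mul_assoc, mul_assoc]
    exact h1.trans (mul_le_mul_right ih _)

theorem DoublingAt.totallyBounded [BorelSpace X] [IsFiniteMeasure ν] (h : DoublingAt K ν D)
    (hK : Bornology.IsBounded K) : TotallyBounded K := by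
  rcases K.eq_empty_or_nonempty with rfl | ⟨x₀, hx₀⟩
  · exact totallyBounded_empty
  rw [Metric.totallyBounded_iff]
  intro ε hε
  obtain ⟨N, hN⟩ := zorn_subset {N : Set X | N ⊆ K ∧ N.Pairwise fun x y => ε ≤ dist x y} (by
    intro c hc hchain
    refine ⟨⋃₀ c, ⟨sUnion_subset fun s hs => (hc hs).1, ?_⟩, fun s hs => subset_sUnion_of_mem hs⟩
    exact (pairwise_sUnion hchain.directedOn).2 fun s hs => (hc hs).2)
  obtain ⟨⟨hNK, hNsep⟩, hmax⟩ := hN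
  obtain ⟨R, hR⟩ := hK.subset_ball x₀
  obtain ⟨n, hn⟩ := pow_unbounded_of_one_lt ((R + 1) / (ε / 2)) (one_lt_two (α := ℝ))
  rw [div_lt_iff₀ (by positivity)] at hn
  -- Balls of radius `ε / 2` about points of `N` are disjoint and their measure is bounded below.
  have hlow : ∀ x : N, ν (Metric.ball x₀ 1) / (D : ℝ≥0∞) ^ n ≤ ν (Metric.ball (x : X) (ε / 2)) := by
    intro x
    refine ENNReal.div_le_of_le_mul' ?_
    refine (measure_mono ?_).trans (h.measure_ball_le (hNK x.2) (half_pos hε) n hn.le)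
    refine Metric.ball_subset_ball' ?_
    have := hR (hNK x.2)
    rw [Metric.mem_ball] at this
    rw [dist_comm]
    linarith
  have hfin : (univ : Set N).Finite := by
    have := Measure.finite_const_le_meas_of_disjoint_iUnion ν
      (ε := ν (Metric.ball x₀ 1) / (D : ℝ≥0∞) ^ n)
      (ENNReal.div_pos (h.pos x₀ hx₀ 1 one_pos).ne' (by finiteness))
      (As := fun x : N => Metric.ball (x : X) (ε / 2))
      (fun x => Metric.isOpen_ball.measurableSet)
      (fun x y hxy => Metric.ball_disjoint_ball (by
        have := hNsep x.2 y.2 (fun h => hxy (Subtype.ext h))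
        linarith)) (by finiteness)
    convert this using 1
    ext x
    simp [hlow x]
  have hNfin : N.Finite := by
    rw [Set.finite_univ_iff] at hfin
    exact hfin
  refine ⟨N, hNfin, fun x hx => ?_⟩
  by_contra hcon
  simp only [mem_iUnion, Metric.mem_ball, exists_prop, not_exists, not_and, not_lt] at hcon
  have hins : insert x N ⊆ N := hmax ⟨insert_subset hx hNK, by
    rw [pairwise_insert]
    exact ⟨hNsep, fun b hb _ => ⟨hcon b hb, by rw [dist_comm]; exact hcon b hb⟩⟩⟩ (subset_insert _ _)
  have := hcon x (hins (mem_insert _ _))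
  rw [dist_self] at this
  linarith

end Doubling

/-! ### Averages over balls with a varying centre -/

section Averages

variable {X : Type*} [MetricSpace X] [MeasurableSpace X] [BorelSpace X] {S : Set X}
  {ν η : Measure X}

/-- As `X` need not be second countable, the set `{d(x, y) < s}` need not be measurable for the
product `σ`-algebra; over a separable set `S` it is, up to modification off `S`. -/
theorem exists_measurableSet_prod_dist_lt (hS : TopologicalSpace.IsSeparable S) (s : ℝ) :
    ∃ E : Set (X × X), MeasurableSet E ∧ (∀ x y, (x, y) ∈ E → dist x y < s) ∧
      ∀ x ∈ S, ∀ y, dist x y < s → (x, y) ∈ E := by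
  obtain ⟨Q, hQ, hSQ⟩ := hS
  refine ⟨⋃ q ∈ Q, ⋃ a : ℚ, Metric.ball q a ×ˢ Metric.ball q (s - a), ?_, ?_, ?_⟩
  · exact MeasurableSet.biUnion hQ fun q _ => MeasurableSet.iUnion fun a =>
      Metric.isOpen_ball.measurableSet.prod Metric.isOpen_ball.measurableSet
  · intro x y hxy
    simp only [mem_iUnion, mem_prod, Metric.mem_ball] at hxy
    obtain ⟨q, -, a, h1, h2⟩ := hxy
    have := dist_triangle_right x y q
    linarith
  · intro x hx y hxy
    obtain ⟨q, hq, hxq⟩ := Metric.mem_closure_iff.1 (hSQ hx) ((s - dist x y) / 2) (by linarith)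
    obtain ⟨a, ha1, ha2⟩ := exists_rat_btwn hxq
    simp only [mem_iUnion, mem_prod, Metric.mem_ball]
    refine ⟨q, hq, a, ha1, ?_⟩
    have := dist_triangle_left y q x
    linarith

theorem aemeasurable_setLIntegral_ball [SFinite ν] (hS : TopologicalSpace.IsSeparable S)
    (hη : η Sᶜ = 0) {f : X → ℝ≥0∞} (hf : AEMeasurable f ν) (s : ℝ) :
    AEMeasurable (fun x => ∫⁻ y in Metric.ball x s, f y ∂ν) η := by
  obtain ⟨E, hE, hE1, hE2⟩ := exists_measurableSet_prod_dist_lt hS s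
  refine ⟨fun x => ∫⁻ y, E.indicator (fun z => hf.mk f z.2) (x, y) ∂ν,
    ((hf.measurable_mk.comp measurable_snd).indicator hE).lintegral_prod_right', ?_⟩
  filter_upwards [mem_ae_iff.2 hη] with x hx
  rw [← lintegral_indicator Metric.isOpen_ball.measurableSet]
  refine lintegral_congr_ae ?_
  filter_upwards [hf.ae_eq_mk] with y hy
  by_cases hxy : dist x y < s
  · rw [indicator_of_mem (by rwa [Metric.mem_ball']), indicator_of_mem (hE2 x hx y hxy), hy]
  · rw [indicator_of_notMem (by rwa [Metric.mem_ball']), indicator_of_notMem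
      (fun h => hxy (hE1 x y h))]

theorem aemeasurable_setLAverage_ball [SFinite ν] (hS : TopologicalSpace.IsSeparable S)
    (hη : η Sᶜ = 0) {f : X → ℝ≥0∞} (hf : AEMeasurable f ν) (s : ℝ) :
    AEMeasurable (fun x => ⨍⁻ y in Metric.ball x s, f y ∂ν) η := by
  simp only [setLAverage_eq]
  refine (aemeasurable_setLIntegral_ball hS hη hf s).div ?_
  simpa using aemeasurable_setLIntegral_ball (ν := ν) hS hη (f := fun _ => 1)
    aemeasurable_const s

theorem aestronglyMeasurable_setAverage_ball {V : Type*} [NormedAddCommGroup V] [NormedSpace ℝ V]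
    [SFinite ν] (hS : TopologicalSpace.IsSeparable S) (hη : η Sᶜ = 0) {u : X → V}
    (hu : AEStronglyMeasurable u ν) (s : ℝ) :
    AEStronglyMeasurable (fun x => ⨍ y in Metric.ball x s, u y ∂ν) η := by
  obtain ⟨E, hE, hE1, hE2⟩ := exists_measurableSet_prod_dist_lt hS s
  simp only [setAverage_eq]
  have hm : AEMeasurable (fun x => ν (Metric.ball x s)) η := by
    simpa using aemeasurable_setLIntegral_ball (ν := ν) hS hη (f := fun _ => 1)
      aemeasurable_const s
  refine AEStronglyMeasurable.smul (f := fun x => (ν.real (Metric.ball x s))⁻¹)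
    hm.ennreal_toReal.inv.aestronglyMeasurable ?_
  refine ⟨fun x => ∫ y, E.indicator (fun z => hu.mk u z.2) (x, y) ∂ν,
    ((hu.stronglyMeasurable_mk.comp_measurable measurable_snd).indicator
      hE).integral_prod_right', ?_⟩
  filter_upwards [mem_ae_iff.2 hη] with x hx
  rw [← integral_indicator Metric.isOpen_ball.measurableSet]
  refine integral_congr_ae ?_
  filter_upwards [hu.ae_eq_mk] with y hy
  by_cases hxy : dist x y < s
  · rw [indicator_of_mem (by rwa [Metric.mem_ball']), indicator_of_mem (hE2 x hx y hxy), hy]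
  · rw [indicator_of_notMem (by rwa [Metric.mem_ball']), indicator_of_notMem
      (fun h => hxy (hE1 x y h))]

/-- Averaging over balls of a fixed radius is bounded from `L¹(ν)` to `L¹(η)` as soon as `η` of a
ball about a point of `S` is controlled by `ν` of the concentric ball of half the radius. -/
theorem lintegral_setLAverage_ball_le [IsFiniteMeasure ν] [SFinite η]
    (hS : TopologicalSpace.IsSeparable S) (hη : η Sᶜ = 0) {k : ℝ≥0}
    (hk : k ≠ 0) {s : ℝ}
    (hK : ∀ x ∈ S, η (Metric.ball x (2 * s)) ≤ k * ν (Metric.ball x s))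
    {f : X → ℝ≥0∞} (hf : AEMeasurable f ν) :
    ∫⁻ x, ⨍⁻ y in Metric.ball x s, f y ∂ν ∂η ≤ k * ∫⁻ y, f y ∂ν := by
  obtain ⟨E, hE, hE1, hE2⟩ := exists_measurableSet_prod_dist_lt hS s
  have hm : AEMeasurable (fun x => ν (Metric.ball x s)) η := by
    simpa using aemeasurable_setLIntegral_ball (ν := ν) hS hη (f := fun _ => 1)
      aemeasurable_const s
  calc ∫⁻ x, ⨍⁻ y in Metric.ball x s, f y ∂ν ∂η
      = ∫⁻ x, ∫⁻ y, E.indicator (fun _ => 1) (x, y) * ((ν (Metric.ball x s))⁻¹ * f y) ∂ν ∂η := by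
        refine lintegral_congr_ae ?_
        filter_upwards [mem_ae_iff.2 hη] with x hx
        rw [setLAverage_eq, ENNReal.div_eq_inv_mul, ← lintegral_indicator
          Metric.isOpen_ball.measurableSet, ← lintegral_const_mul'' _
            (hf.indicator Metric.isOpen_ball.measurableSet)]
        refine lintegral_congr fun y => ?_
        by_cases hxy : dist x y < s
        · rw [indicator_of_mem (by rwa [Metric.mem_ball']), indicator_of_mem (hE2 x hx y hxy),
            one_mul]
        · rw [indicator_of_notMem (by rwa [Metric.mem_ball']), indicator_of_notMem
            (fun h => hxy (hE1 x y h)), mul_zero, zero_mul]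
    _ = ∫⁻ y, ∫⁻ x, E.indicator (fun _ => 1) (x, y) * ((ν (Metric.ball x s))⁻¹ * f y) ∂η ∂ν := by
        refine lintegral_lintegral_swap ?_
        exact ((measurable_one.indicator hE).aemeasurable).mul (hm.inv.comp_fst.mul hf.comp_snd)
    _ ≤ ∫⁻ y, k * f y ∂ν := by
        refine lintegral_mono fun y => ?_
        calc ∫⁻ x, E.indicator (fun _ => 1) (x, y) * ((ν (Metric.ball x s))⁻¹ * f y) ∂η
            ≤ ∫⁻ x, (Metric.ball y s).indicator
                (fun _ => k * (η (Metric.ball y s))⁻¹ * f y) x ∂η := by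
              refine lintegral_mono_ae ?_
              filter_upwards [mem_ae_iff.2 hη] with x hx
              by_cases hxy : (x, y) ∈ E
              · have hd := hE1 x y hxy
                rw [indicator_of_mem hxy, indicator_of_mem (by rwa [Metric.mem_ball]), one_mul]
                refine mul_le_mul_left ?_ _
                have hle : η (Metric.ball y s) ≤ k * ν (Metric.ball x s) :=
                  (measure_mono (Metric.ball_subset_ball' (by
                    rw [dist_comm]; linarith))).trans (hK x hx)
                have hk' : (k : ℝ≥0∞) ≠ 0 := by simpa using hk
                calc (ν (Metric.ball x s))⁻¹
                    = k * (k * ν (Metric.ball x s))⁻¹ := by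
                      rw [ENNReal.mul_inv (Or.inl hk') (Or.inl ENNReal.coe_ne_top), ← mul_assoc,
                        ENNReal.mul_inv_cancel hk' ENNReal.coe_ne_top, one_mul]
                  _ ≤ k * (η (Metric.ball y s))⁻¹ :=
                      mul_le_mul_right (ENNReal.inv_le_inv.2 hle) _
              · rw [indicator_of_notMem hxy, zero_mul]
                exact zero_le
          _ ≤ k * f y := by
              rw [lintegral_indicator Metric.isOpen_ball.measurableSet, setLIntegral_const]
              calc k * (η (Metric.ball y s))⁻¹ * f y * η (Metric.ball y s)
                  = k * f y * ((η (Metric.ball y s))⁻¹ * η (Metric.ball y s)) := by ring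
                _ ≤ k * f y * 1 := mul_le_mul_right (ENNReal.inv_mul_le_one _) _
                _ = k * f y := mul_one _
    _ = k * ∫⁻ y, f y ∂ν := lintegral_const_mul'' _ hf

end Averages

/-! ### Integral inequalities -/

section Inequalities

variable {α : Type*} [MeasurableSpace α] {ν : Measure α} {p : ℝ}

theorem lintegral_rpow_sum_le (hp : 1 ≤ p) {f : ℕ → α → ℝ≥0∞} (hf : ∀ n, AEMeasurable (f n) ν)
    (n : ℕ) :
    (∫⁻ x, (∑ i ∈ Finset.range n, f i x) ^ p ∂ν) ^ (1 / p) ≤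
      ∑ i ∈ Finset.range n, (∫⁻ x, f i x ^ p ∂ν) ^ (1 / p) := by
  have hp0 : 0 < p := by linarith
  induction n with
  | zero => simp [hp0]
  | succ n ih =>
    simp only [Finset.sum_range_succ]
    refine (ENNReal.lintegral_Lp_add_le (f := fun x => ∑ i ∈ Finset.range n, f i x)
      (Finset.aemeasurable_fun_sum _ fun i _ => hf i) (hf n) hp).trans ?_
    exact add_le_add ih le_rfl

/-- Minkowski's inequality for countable sums of `[0, ∞]`-valued functions. -/
theorem lintegral_rpow_tsum_le (hp : 1 ≤ p) {f : ℕ → α → ℝ≥0∞}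
    (hf : ∀ n, AEMeasurable (f n) ν) :
    (∫⁻ x, (∑' i, f i x) ^ p ∂ν) ^ (1 / p) ≤ ∑' i, (∫⁻ x, f i x ^ p ∂ν) ^ (1 / p) := by
  have hp0 : 0 < p := by linarith
  have hmono : ∀ x, Monotone fun n => (∑ i ∈ Finset.range n, f i x) ^ p := fun x m n hmn =>
    ENNReal.rpow_le_rpow (Finset.sum_le_sum_of_subset (Finset.range_subset_range.2 hmn)) hp0.le
  have hlim := lintegral_tendsto_of_tendsto_of_monotone (μ := ν)
    (f := fun n x => (∑ i ∈ Finset.range n, f i x) ^ p) (F := fun x => (∑' i, f i x) ^ p)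
    (fun n => (Finset.aemeasurable_fun_sum _ fun i _ => hf i).pow_const p)
    (Eventually.of_forall hmono)
    (Eventually.of_forall fun x => (ENNReal.continuous_rpow_const.tendsto _).comp
      (ENNReal.tendsto_nat_tsum fun i => f i x))
  refine le_of_tendsto ((ENNReal.continuous_rpow_const.tendsto _).comp hlim)
    (Eventually.of_forall fun n => ?_)
  exact (lintegral_rpow_sum_le hp hf n).trans (ENNReal.sum_le_tsum _)

theorem setLAverage_rpow_le [IsFiniteMeasure ν] (hp : 1 ≤ p) {s : Set α} (hs : ν s ≠ 0)
    {f : α → ℝ≥0∞} (hf : AEMeasurable f (ν.restrict s)) :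
    ⨍⁻ x in s, f x ^ (1 / p) ∂ν ≤ (⨍⁻ x in s, f x ∂ν) ^ (1 / p) := by
  have hp0 : 0 < p := by linarith
  have : NeZero (ν.restrict s) := ⟨Measure.restrict_eq_zero.not.2 hs⟩
  have hm : AEMeasurable (fun x => f x ^ (1 / p)) (((ν.restrict s) univ)⁻¹ • ν.restrict s) :=
    (hf.pow_const _).smul_measure _
  have h := eLpNorm'_le_eLpNorm'_of_exponent_le one_pos hp
    (((ν.restrict s) univ)⁻¹ • ν.restrict s) hm.aestronglyMeasurable
  simp only [eLpNorm'_eq_lintegral_enorm, enorm_eq_self, ENNReal.rpow_one, div_one,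
    ← ENNReal.rpow_mul, one_div_mul_cancel hp0.ne'] at h
  exact h

theorem setLAverage_le_mul_setLAverage [IsFiniteMeasure ν] {s t : Set α} (hst : s ⊆ t)
    {c : ℝ≥0∞} (hc : ν t ≤ c * ν s) (f : α → ℝ≥0∞) :
    ⨍⁻ x in s, f x ∂ν ≤ c * ⨍⁻ x in t, f x ∂ν := by
  rw [setLAverage_eq]
  refine ENNReal.div_le_of_le_mul ?_
  calc ∫⁻ x in s, f x ∂ν ≤ ∫⁻ x in t, f x ∂ν := lintegral_mono_set hst
    _ = ν t * ⨍⁻ x in t, f x ∂ν := (measure_mul_setLAverage f (measure_ne_top _ _)).symm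
    _ ≤ c * ν s * ⨍⁻ x in t, f x ∂ν := mul_le_mul_left hc _
    _ = c * (⨍⁻ x in t, f x ∂ν) * ν s := by ring

theorem enorm_setAverage_sub_le {V : Type*} [NormedAddCommGroup V] [NormedSpace ℝ V]
    [CompleteSpace V] [IsFiniteMeasure ν] {s : Set α} (hs : ν s ≠ 0) {u : α → V}
    (hu : Integrable u ν) (c : V) :
    ‖(⨍ x in s, u x ∂ν) - c‖ₑ ≤ ⨍⁻ x in s, ‖u x - c‖ₑ ∂ν := by
  have : NeZero (ν.restrict s) := ⟨Measure.restrict_eq_zero.not.2 hs⟩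
  have h : (⨍ x in s, u x ∂ν) - c = ⨍ x in s, (u x - c) ∂ν := by
    conv_lhs => rw [← average_const (ν.restrict s) c]
    exact (integral_sub hu.restrict.to_average (integrable_const c).to_average).symm
  rw [h]
  exact enorm_integral_le_lintegral_enorm _

theorem setLAverage_add_const_le [IsFiniteMeasure ν] {s : Set α} (f : α → ℝ≥0∞)
    (c : ℝ≥0∞) : ⨍⁻ x in s, (f x + c) ∂ν ≤ (⨍⁻ x in s, f x ∂ν) + c := by
  rw [laverage, laverage, lintegral_add_right _ measurable_const, lintegral_const]
  refine add_le_add le_rfl (mul_le_of_le_one_right' ?_)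
  simp only [Measure.smul_apply, smul_eq_mul]
  exact ENNReal.inv_mul_le_one _

end Inequalities

/-! ### Approximation by averages over small balls -/

section Lebesgue

variable {X V : Type*} [MetricSpace X] [MeasurableSpace X] [BorelSpace X] {K : Set X}
  {ν : Measure X} {D : ℝ≥0} [NormedAddCommGroup V] [NormedSpace ℝ V] [CompleteSpace V]

/-- The averages of an integrable map over balls of radius `s` converge to it in `L¹` as `s → 0`.
The error is dominated by a measurable `w`: sums of such bounds can be integrated termwise, which
fails for lower integrals of functions that are not measurable. -/
theorem exists_lintegral_setAverage_sub_le [IsFiniteMeasure ν] (h : DoublingAt K ν D)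
    (hK : IsCompact K) (hν : ν Kᶜ = 0) {u : X → V} (hu : Integrable u ν) {ε : ℝ≥0}
    (hε : 0 < ε) :
    ∃ δ > 0, ∀ s, 0 < s → s < δ → ∃ w : X → ℝ≥0∞, AEMeasurable w ν ∧
      (∀ x ∈ K, ‖u x - ⨍ y in Metric.ball x s, u y ∂ν‖ₑ ≤ w x) ∧ ∫⁻ x, w x ∂ν ≤ ε := by
  set c : ℝ≥0 := 1 + D + (ν univ).toNNReal with hc
  have hc' : (c : ℝ≥0∞) = 1 + D + ν univ := by
    rw [hc]; push_cast; rw [ENNReal.coe_toNNReal (measure_ne_top _ _)]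
  have hc0 : 0 < c := by positivity
  set e : ℝ≥0 := ε / c with he
  have he0 : 0 < e := by positivity
  obtain ⟨φ, hφ, hφm⟩ := (memLp_one_iff_integrable.2 hu).exists_boundedContinuous_eLpNorm_sub_le
    ENNReal.one_ne_top (ENNReal.coe_ne_zero.2 he0.ne')
  rw [eLpNorm_one_eq_lintegral_enorm] at hφ
  have hsub : Integrable (u - ⇑φ) ν := hu.sub (memLp_one_iff_integrable.1 hφm)
  obtain ⟨δ, hδ, hδ'⟩ := Metric.uniformContinuousOn_iff.1
    (hK.uniformContinuousOn_of_continuous φ.continuous.continuousOn) e he0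
  have hmeas : AEMeasurable (fun x => ‖(u - ⇑φ) x‖ₑ) ν := hsub.1.enorm
  have hsep := hK.isSeparable
  refine ⟨δ, hδ, fun s hs hsδ => ⟨fun x => ‖(u - ⇑φ) x‖ₑ +
    ((⨍⁻ y in Metric.ball x s, ‖(u - ⇑φ) y‖ₑ ∂ν) + e), ?_, ?_, ?_⟩⟩
  · exact hmeas.add ((aemeasurable_setLAverage_ball hsep hν hmeas s).add aemeasurable_const)
  · intro x hx
    have h1 : ‖u x - ⨍ y in Metric.ball x s, u y ∂ν‖ₑ ≤
        ‖u x - φ x‖ₑ + ‖(⨍ y in Metric.ball x s, u y ∂ν) - φ x‖ₑ := by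
      rw [← enorm_neg ((⨍ y in Metric.ball x s, u y ∂ν) - φ x), neg_sub]
      convert enorm_add_le (u x - φ x) (φ x - ⨍ y in Metric.ball x s, u y ∂ν) using 2
      abel
    refine h1.trans (add_le_add le_rfl ?_)
    refine (enorm_setAverage_sub_le (h.pos x hx s hs).ne' hu _).trans ?_
    refine le_trans ?_ (setLAverage_add_const_le _ _)
    refine laverage_mono_ae ?_
    filter_upwards [ae_restrict_mem Metric.isOpen_ball.measurableSet,
      ae_restrict_of_ae (mem_ae_iff.2 hν)] with y hy hyK
    have h2 : ‖φ y - φ x‖ₑ ≤ e := by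
      rw [← edist_eq_enorm_sub, edist_nndist]
      exact_mod_cast (hδ' y hyK x hx (lt_trans hy hsδ)).le
    refine le_trans ?_ (add_le_add le_rfl h2)
    rw [show u y - φ x = (u - ⇑φ) y + (φ y - φ x) by rw [Pi.sub_apply]; abel]
    exact enorm_add_le _ _
  · have h3 := lintegral_setLAverage_ball_le (ν := ν) (η := ν) hsep hν
      (zero_lt_one.trans_le h.one_le).ne' (s := s) (fun x hx => h.le x hx s hs) hmeas
    rw [lintegral_add_left' hmeas, lintegral_add_right _ measurable_const, lintegral_const]
    calc _ ≤ (e : ℝ≥0∞) + (D * e + e * ν univ) := by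
          gcongr
          exact h3.trans (by gcongr)
      _ = e * c := by rw [hc']; ring
      _ = ε := by
          rw [← ENNReal.coe_mul, he, div_mul_cancel₀ _ hc0.ne']

end Lebesgue

/-! ### Weak upper gradients -/

section UpperGradient

variable {X Z : Type*} [MetricSpace X] {Ω : Set X}

theorem MetricTrace.RectCurve.sum_lineIntegral_le (γ : RectCurve Ω) (f : ℕ → X → ℝ≥0∞) (n : ℕ) :
    ∑ i ∈ Finset.range n, γ.lineIntegral (f i) ≤
      γ.lineIntegral (fun x => ∑ i ∈ Finset.range n, f i x) := by
  induction n with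
  | zero => simp
  | succ n ih =>
    rw [Finset.sum_range_succ]
    refine (add_le_add ih le_rfl).trans ((γ.lineIntegral_add_le _ _).trans ?_)
    refine γ.lineIntegral_mono fun x => ?_
    simp [Finset.sum_range_succ]

variable [MeasurableSpace X] {μ : Measure X} {p : ℝ}

/-- A curve family of `p`-modulus zero carries a function of small `L^p`-norm whose line integral
along every curve of the family is infinite. -/
theorem exists_lineIntegral_eq_top (hp : 1 ≤ p) {Γ : Set (RectCurve Ω)}
    (hΓ : modulus Ω μ p Γ = 0) {ε : ℝ≥0∞} (hε : ε ≠ 0) :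
    ∃ ρ : X → ℝ≥0∞, Measurable ρ ∧ (∀ γ ∈ Γ, γ.lineIntegral ρ = ∞) ∧ lpNorm Ω μ p ρ ≤ ε := by
  have hp0 : 0 < p := by linarith
  obtain ⟨δ, hδ, hδε⟩ := ENNReal.exists_pos_sum_of_countable hε ℕ
  have hex : ∀ n, ∃ ρ : X → ℝ≥0∞, Measurable ρ ∧ (∀ γ ∈ Γ, 1 ≤ γ.lineIntegral ρ) ∧
      lpNorm Ω μ p ρ ≤ δ n := by
    intro n
    have hlt : modulus Ω μ p Γ < (δ n : ℝ≥0∞) ^ p := by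
      rw [hΓ]
      exact ENNReal.rpow_pos (by exact_mod_cast hδ n) ENNReal.coe_ne_top
    simp only [modulus, iInf_lt_iff] at hlt
    obtain ⟨ρ, hρ, hρ', hlt⟩ := hlt
    refine ⟨ρ, hρ, hρ', ?_⟩
    rw [MetricTrace.lpNorm, one_div, ENNReal.rpow_inv_le_iff hp0]
    exact hlt.le
  choose ρ hρ hρ' hρδ using hex
  refine ⟨fun x => ∑' n, ρ n x, Measurable.tsum hρ, fun γ hγ => ?_, ?_⟩
  · refine ENNReal.eq_top_of_forall_nnreal_le fun r => ?_
    obtain ⟨n, hn⟩ := exists_nat_ge r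
    calc (r : ℝ≥0∞) ≤ n := by exact_mod_cast hn
      _ = ∑ i ∈ Finset.range n, (1 : ℝ≥0∞) := by simp
      _ ≤ ∑ i ∈ Finset.range n, γ.lineIntegral (ρ i) := Finset.sum_le_sum fun i _ => hρ' i γ hγ
      _ ≤ _ := γ.sum_lineIntegral_le ρ n
      _ ≤ _ := γ.lineIntegral_mono fun x => ENNReal.sum_le_tsum _
  · refine (lintegral_rpow_tsum_le hp fun n => (hρ n).aemeasurable).trans ?_
    exact (ENNReal.tsum_le_tsum hρδ).trans hδε.le

/-- Upper gradients suffice to compute the Dirichlet seminorm. -/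
theorem exists_isUpperGradient_of_gradNorm_lt [PseudoEMetricSpace Z] (hp : 1 ≤ p) {u : X → Z}
    {t : ℝ≥0∞} (ht : gradNorm Ω μ p u < t) :
    ∃ g : X → ℝ≥0∞, IsUpperGradient Ω g u ∧ lpNorm Ω μ p g < t := by
  simp only [gradNorm, iInf_lt_iff] at ht
  obtain ⟨g, ⟨hg, hΓ⟩, hgt⟩ := ht
  obtain ⟨ε, hε, hεt⟩ : ∃ ε : ℝ≥0∞, ε ≠ 0 ∧ lpNorm Ω μ p g + ε < t := by
    obtain ⟨c, hc, hct⟩ := exists_between hgt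
    exact ⟨c - lpNorm Ω μ p g, (tsub_pos_of_lt hc).ne', by rwa [add_tsub_cancel_of_le hc.le]⟩
  obtain ⟨ρ, hρ, hρΓ, hρε⟩ := exists_lineIntegral_eq_top hp hΓ hε
  refine ⟨g + ρ, ⟨hg.add hρ, fun γ => ?_⟩,
    ((lpNorm_add_le hp hg hρ).trans (add_le_add le_rfl hρε)).trans_lt hεt⟩
  refine le_trans ?_ (γ.lineIntegral_add_le g ρ)
  by_cases hγ : UpperGradientIneq g u γ
  · exact le_add_right hγ
  · rw [hρΓ γ hγ, add_top]
    exact le_top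

end UpperGradient

/-! ### The Poincaré inequality for Banach-valued maps -/

section Poincare

theorem MetricTrace.IsUpperGradient.clm_comp {X V : Type*} [MetricSpace X]
    [MeasurableSpace X] [NormedAddCommGroup V] [NormedSpace ℝ V] {Ω : Set X} {u : X → V} {g : X → ℝ≥0∞} (hg : IsUpperGradient Ω g u)
    {l : V →L[ℝ] ℝ} (hl : ‖l‖ ≤ 1) : IsUpperGradient Ω g (l ∘ u) := by
  refine ⟨hg.1, fun γ => le_trans ?_ (hg.2 γ)⟩
  have h := l.lipschitz (u (γ.toFun γ.b)) (u (γ.toFun γ.a))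
  refine h.trans (mul_le_of_le_one_left' ?_)
  exact_mod_cast hl

variable {X : Type*} [MetricSpace X] [MeasurableSpace X] {Ω : Set X}
  {μ : Measure X} {p : ℝ} {D : ℝ≥0} {V : Type*} [NormedAddCommGroup V] [NormedSpace ℝ V]

/-- The means of `u` over nested balls of comparable radii `s` and `t` differ by at most `C * t`
times the `p`-mean of `g` over the larger ball, enlarged by the factor `lam`. The larger ball is
centred in `Ω`, where the Poincaré inequality is available, the smaller one possibly at the
boundary. -/
def NestedMeanBound (Ω : Set X) (ν : Measure X) (p : ℝ) (C : ℝ≥0) (lam : ℝ) (u : X → V)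
    (g : X → ℝ≥0∞) : Prop :=
  ∀ a ∈ closure Ω, ∀ b ∈ Ω, ∀ s t : ℝ, 0 < s → t ≤ 4 * s →
    Metric.ball a s ⊆ Metric.ball b t →
    ‖(⨍ y in Metric.ball a s, u y ∂ν) - ⨍ y in Metric.ball b t, u y ∂ν‖ₑ ≤
      C * ENNReal.ofReal t * (⨍⁻ y in Metric.ball b (lam * t), g y ^ p ∂ν) ^ (1 / p)

/-- The means over the balls `B(x, t 2⁻ʲ)`, chained from `j = 0` to `j = n`. -/
theorem NestedMeanBound.enorm_sub_le {ν : Measure X} {C : ℝ≥0} {lam : ℝ} {u : X → V}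
    {g : X → ℝ≥0∞} (hu : NestedMeanBound Ω ν p C lam u g) {x : X} (hx : x ∈ Ω) {t : ℝ}
    (ht : 0 < t) (n : ℕ) :
    ‖(⨍ y in Metric.ball x (t * 2⁻¹ ^ n), u y ∂ν) - ⨍ y in Metric.ball x t, u y ∂ν‖ₑ ≤
      ∑ j ∈ Finset.range n, C * ENNReal.ofReal (t * 2⁻¹ ^ j) *
        (⨍⁻ y in Metric.ball x (lam * (t * 2⁻¹ ^ j)), g y ^ p ∂ν) ^ (1 / p) := by
  induction n with
  | zero => simp
  | succ n ih =>
    rw [Finset.sum_range_succ, add_comm (∑ j ∈ Finset.range n, _)]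
    have h1 := hu x (subset_closure hx) x hx (t * 2⁻¹ ^ (n + 1)) (t * 2⁻¹ ^ n) (by positivity)
      (by rw [pow_succ]; nlinarith [show 0 < t * 2⁻¹ ^ n by positivity])
      (Metric.ball_subset_ball (by rw [pow_succ]; nlinarith [show 0 < t * 2⁻¹ ^ n by positivity]))
    refine le_trans ?_ (add_le_add h1 ih)
    refine le_trans (le_of_eq ?_) (enorm_add_le _ _)
    congr 1
    abel

variable [BorelSpace X] [CompleteSpace V]

theorem restrict_ball_inter (x : X) (r : ℝ) :
    μ.restrict (Metric.ball x r ∩ Ω) = (μ.restrict Ω).restrict (Metric.ball x r) :=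
  (Measure.restrict_restrict Metric.isOpen_ball.measurableSet).symm

/-- A difference `d` of two means of `u` has the norm of the corresponding difference for `l ∘ u`,
where `l` is a norming functional of `d`. Hence the Poincaré inequality for real functions bounds
it directly; the mean oscillation of `u` has no such description by a single functional. -/
theorem exists_nestedMeanBound [IsFiniteMeasure (μ.restrict Ω)]
    (h : DoublingAt (closure Ω) (μ.restrict Ω) D) (hP : LocalPoincare Ω μ p) :
    ∃ (C : ℝ≥0) (lam : ℝ), 1 ≤ lam ∧ ∀ u : X → V, Integrable u (μ.restrict Ω) →
      ∀ g : X → ℝ≥0∞, IsUpperGradient Ω g u →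
        NestedMeanBound Ω (μ.restrict Ω) p C lam u g := by
  obtain ⟨C, lam, hC, hlam, hP⟩ := hP
  refine ⟨D ^ 3 * C.toNNReal, lam, hlam, fun u hu g hg a ha b hb s t hs hts hst => ?_⟩
  set ν := μ.restrict Ω
  have hat : dist a b < t := hst (Metric.mem_ball_self hs)
  have ht : 0 < t := dist_nonneg.trans_lt hat
  have hA := (h.pos a ha s hs).ne'
  have hBA : ν (Metric.ball b t) ≤ (D : ℝ≥0∞) ^ 3 * ν (Metric.ball a s) := by
    refine (measure_mono (Metric.ball_subset_ball' (ε₂ := 8 * s) ?_)).trans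
      (h.measure_ball_le ha hs 3 (by norm_num))
    rw [dist_comm]
    linarith
  obtain ⟨l, hl, hlw⟩ := exists_dual_vector'' ℝ
    ((⨍ y in Metric.ball a s, u y ∂ν) - ⨍ y in Metric.ball b t, u y ∂ν)
  have hcomm : ∀ (x : X) (r : ℝ),
      l (⨍ y in Metric.ball x r, u y ∂ν) = ⨍ y in Metric.ball x r, (l ∘ u) y ∂ν := fun x r =>
    (l.integral_comp_comm hu.restrict.to_average).symm
  have hlu : Integrable (l ∘ u) ν := l.integrable_comp hu
  have hpoin := hP b hb t ht (l ∘ u) (IntegrableOn.locallyIntegrableOn hlu) g (hg.clm_comp hl)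
  simp only [restrict_ball_inter] at hpoin
  calc ‖(⨍ y in Metric.ball a s, u y ∂ν) - ⨍ y in Metric.ball b t, u y ∂ν‖ₑ
      = ‖(⨍ y in Metric.ball a s, (l ∘ u) y ∂ν) - ⨍ y in Metric.ball b t, (l ∘ u) y ∂ν‖ₑ := by
        rw [← hcomm, ← hcomm, ← map_sub, hlw, RCLike.ofReal_real_eq_id, id, enorm_norm]
    _ ≤ ⨍⁻ x in Metric.ball a s, ‖(l ∘ u) x - ⨍ y in Metric.ball b t, (l ∘ u) y ∂ν‖ₑ ∂ν :=
        enorm_setAverage_sub_le hA hlu _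
    _ ≤ D ^ 3 * ⨍⁻ x in Metric.ball b t, ‖(l ∘ u) x - ⨍ y in Metric.ball b t, (l ∘ u) y ∂ν‖ₑ ∂ν :=
        setLAverage_le_mul_setLAverage hst hBA _
    _ ≤ D ^ 3 * (ENNReal.ofReal (C * t) *
          (⨍⁻ y in Metric.ball b (lam * t), g y ^ p ∂ν) ^ (1 / p)) := mul_le_mul_right hpoin _
    _ = _ := by
        rw [ENNReal.ofReal_mul hC.le]
        push_cast
        rw [← mul_assoc, ← mul_assoc]
        rfl

theorem sum_geometric_two_inv_le {t : ℝ} (ht : 0 < t) (n : ℕ) :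
    ∑ j ∈ Finset.range n, ENNReal.ofReal (t * 2⁻¹ ^ j) ≤ ENNReal.ofReal (2 * t) := by
  rw [← ENNReal.ofReal_sum_of_nonneg fun j _ => by positivity]
  refine ENNReal.ofReal_le_ofReal ?_
  have h : ∑ j ∈ Finset.range n, t * 2⁻¹ ^ j = 2 * t - 2 * t * 2⁻¹ ^ n := by
    induction n with
    | zero => simp
    | succ n ih => rw [Finset.sum_range_succ, ih, pow_succ]; ring
  rw [h]
  have : 0 < 2 * t * 2⁻¹ ^ n := by positivity
  linarith

/-- Averaging twice: the mean over `x ∈ B(z, r)` of the root of the mean of `G` over `B(x, s)` is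
controlled by the mean of `G` over a larger ball. -/
theorem setLAverage_setLAverage_rpow_le {K : Set X} {ν : Measure X} [IsFiniteMeasure ν]
    (hp : 1 ≤ p) (h : DoublingAt K ν D) (hK : IsCompact K) (hν : ν Kᶜ = 0) {z : X} (hz : z ∈ K)
    {r s : ℝ} (hr : 0 < r) (hs : 0 < s) {R : ℝ} (hR : r + s ≤ R) {m : ℕ} (hm : R ≤ 2 ^ m * r)
    {G : X → ℝ≥0∞} (hG : Measurable G) :
    ⨍⁻ x in Metric.ball z r, (⨍⁻ y in Metric.ball x s, G y ∂ν) ^ (1 / p) ∂ν ≤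
      (D ^ (m + 1) * ⨍⁻ y in Metric.ball z R, G y ∂ν) ^ (1 / p) := by
  have hη : ν.restrict (Metric.ball z r) Kᶜ = 0 :=
    le_antisymm ((Measure.restrict_apply_le _ _).trans hν.le) zero_le
  have hmeas := aemeasurable_setLAverage_ball (ν := ν) hK.isSeparable hη hG.aemeasurable s
  refine (setLAverage_rpow_le hp (h.pos z hz r hr).ne' hmeas).trans ?_
  refine ENNReal.rpow_le_rpow ?_ (by positivity)
  have hB : MeasurableSet (Metric.ball z R) := Metric.isOpen_ball.measurableSet
  have h1 := lintegral_setLAverage_ball_le (ν := ν) hK.isSeparable hη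
    (zero_lt_one.trans_le h.one_le).ne' (s := s) (fun x hx =>
      (Measure.restrict_apply_le _ _).trans (h.le x hx s hs)) (hG.indicator hB).aemeasurable
  rw [lintegral_indicator hB] at h1
  have h2 : ∫⁻ x in Metric.ball z r, ⨍⁻ y in Metric.ball x s, G y ∂ν ∂ν ≤
      D * ∫⁻ y in Metric.ball z R, G y ∂ν := by
    refine le_trans (le_of_eq (setLIntegral_congr_fun Metric.isOpen_ball.measurableSet
      fun x hx => ?_)) h1
    refine setLAverage_congr_fun Metric.isOpen_ball.measurableSet fun y hy => ?_
    rw [indicator_of_mem]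
    rw [Metric.mem_ball] at hx hy ⊢
    linarith [dist_triangle y x z]
  rw [setLAverage_eq]
  refine ENNReal.div_le_of_le_mul (h2.trans ?_)
  rw [← measure_mul_setLAverage G (measure_ne_top ν (Metric.ball z R))]
  calc D * (ν (Metric.ball z R) * ⨍⁻ y in Metric.ball z R, G y ∂ν)
      ≤ D * (D ^ m * ν (Metric.ball z r) * ⨍⁻ y in Metric.ball z R, G y ∂ν) := by
        gcongr
        exact h.measure_ball_le hz hr m hm
    _ = _ := by ring

/-- A bound on the differences of means over nested balls implies a `p`-Poincaré inequality, also
for balls centred at the boundary: for a.e. `x` in the ball, `u x` is joined to the mean of `u`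
by a chain of means over balls that shrink to `x`, and the resulting sum is integrated over `x`
before any maximal function is taken. -/
theorem exists_poincare_of_nestedMeanBound [IsFiniteMeasure (μ.restrict Ω)] (hp : 1 ≤ p)
    (hΩ : IsOpen Ω) (h : DoublingAt (closure Ω) (μ.restrict Ω) D) (hK : IsCompact (closure Ω))
    (C : ℝ≥0) {lam : ℝ} (hlam : 1 ≤ lam) :
    ∃ (C' : ℝ≥0) (Lam : ℝ), 1 ≤ Lam ∧ ∀ u : X → V, Integrable u (μ.restrict Ω) →
      ∀ g : X → ℝ≥0∞, Measurable g → NestedMeanBound Ω (μ.restrict Ω) p C lam u g →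
        ∀ z ∈ closure Ω, ∀ r : ℝ, 0 < r →
          ⨍⁻ x in Metric.ball z r, ‖u x - ⨍ y in Metric.ball z r, u y ∂μ.restrict Ω‖ₑ
            ∂μ.restrict Ω ≤
          C' * ENNReal.ofReal r *
            (⨍⁻ y in Metric.ball z (Lam * r), g y ^ p ∂μ.restrict Ω) ^ (1 / p) := by
  set ν := μ.restrict Ω
  obtain ⟨m, hm⟩ := pow_unbounded_of_one_lt (1 + 2 * lam) (one_lt_two (α := ℝ))
  refine ⟨C * 6 * (D ^ (m + 1)) ^ (1 / p), 1 + 2 * lam, by linarith,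
    fun u hu g hg hN z hz r hr => ?_⟩
  have hνK : ν (closure Ω)ᶜ = 0 := by
    rw [Measure.restrict_apply isClosed_closure.measurableSet.compl]
    exact measure_mono_null (fun x hx => hx.1 (subset_closure hx.2)) measure_empty
  have hB := (h.pos z hz r hr).ne'
  set M : ℝ≥0∞ := (D ^ (m + 1) * ⨍⁻ y in Metric.ball z ((1 + 2 * lam) * r), g y ^ p ∂ν) ^ (1 / p)
    with hM
  have hGm : Measurable fun y => g y ^ p := hg.pow_const p
  have hη : (ν.restrict (Metric.ball z r)) (closure Ω)ᶜ = 0 :=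
    le_antisymm ((Measure.restrict_apply_le _ _).trans hνK.le) zero_le
  have hA : ∀ j : ℕ, ⨍⁻ x in Metric.ball z r,
      (⨍⁻ y in Metric.ball x (lam * (2 * r * 2⁻¹ ^ j)), g y ^ p ∂ν) ^ (1 / p) ∂ν ≤ M := by
    intro j
    have hj : (2 : ℝ)⁻¹ ^ j ≤ 1 := pow_le_one₀ (by norm_num) (by norm_num)
    refine setLAverage_setLAverage_rpow_le hp h hK hνK hz hr (by positivity) ?_ ?_ hGm
    · have : lam * (2 * r * 2⁻¹ ^ j) ≤ lam * (2 * r * 1) := by gcongr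
      linarith
    · exact mul_le_mul_of_nonneg_right hm.le hr.le
  set A : ℕ → X → ℝ≥0∞ := fun j x => C * ENNReal.ofReal (2 * r * 2⁻¹ ^ j) *
    (⨍⁻ y in Metric.ball x (lam * (2 * r * 2⁻¹ ^ j)), g y ^ p ∂ν) ^ (1 / p)
  have hAm : ∀ j : ℕ, AEMeasurable (A j)
      ((ν.restrict (Metric.ball z r) univ)⁻¹ • ν.restrict (Metric.ball z r)) := fun j =>
    (((aemeasurable_setLAverage_ball hK.isSeparable hη hGm.aemeasurable _).pow_const _).const_mul
      _).smul_measure _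
  have hAC : ∀ j : ℕ, ⨍⁻ x in Metric.ball z r, A j x ∂ν ≤
      C * ENNReal.ofReal (2 * r * 2⁻¹ ^ j) * M := by
    intro j
    rw [laverage, lintegral_const_mul' _ _ (by finiteness)]
    exact mul_le_mul_right (hA j) _
  have hgoal : C * 6 * (D ^ (m + 1)) ^ (1 / p) * ENNReal.ofReal r *
      (⨍⁻ y in Metric.ball z ((1 + 2 * lam) * r), g y ^ p ∂ν) ^ (1 / p) =
      C * ENNReal.ofReal (6 * r) * M := by
    rw [hM, ENNReal.mul_rpow_of_nonneg _ _ (by positivity), ENNReal.ofReal_mul (by norm_num),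
      ENNReal.ofReal_ofNat]
    ring
  have hcast : ((C * 6 * (D ^ (m + 1)) ^ (1 / p) : ℝ≥0) : ℝ≥0∞) =
      C * 6 * (D ^ (m + 1)) ^ (1 / p) := by
    push_cast
    rw [ENNReal.coe_rpow_of_nonneg _ (by positivity)]
    push_cast
    rfl
  rw [hcast, hgoal]
  refine ENNReal.le_of_forall_pos_le_add fun ε hε _ => ?_
  -- The error of the approximation of `u x` by its mean over the last ball of the chain.
  have hνB : ν (Metric.ball z r) ≠ ∞ := measure_ne_top _ _
  obtain ⟨δ, hδ, hδ'⟩ := exists_lintegral_setAverage_sub_le h hK hνK hu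
    (ε := ε * (ν (Metric.ball z r)).toNNReal)
    (mul_pos hε (ENNReal.toNNReal_pos hB hνB))
  obtain ⟨n, hn⟩ := exists_pow_lt_of_lt_one (show 0 < δ / (2 * r) by positivity)
    (show (2 : ℝ)⁻¹ < 1 by norm_num)
  obtain ⟨w, hw, hwu, hwε⟩ := hδ' (2 * r * 2⁻¹ ^ n) (by positivity) (by
    rw [lt_div_iff₀ (by positivity)] at hn
    linarith)
  have hwB : ⨍⁻ x in Metric.ball z r, w x ∂ν ≤ ε := by
    rw [setLAverage_eq]
    refine ENNReal.div_le_of_le_mul ((setLIntegral_le_lintegral _ _).trans (hwε.trans ?_))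
    rw [ENNReal.coe_mul, ENNReal.coe_toNNReal hνB]
  have hpt : ∀ᵐ x ∂ν.restrict (Metric.ball z r),
      ‖u x - ⨍ y in Metric.ball z r, u y ∂ν‖ₑ ≤
        (∑ j ∈ Finset.range n, A j x) + A 0 x + w x := by
    filter_upwards [ae_restrict_mem Metric.isOpen_ball.measurableSet,
      ae_restrict_of_ae (ae_restrict_mem hΩ.measurableSet)] with x hxz hxΩ
    have h1 := hN.enorm_sub_le hxΩ (show 0 < 2 * r by positivity) n
    have h2 := hN z hz x hxΩ r (2 * r) hr (by linarith) (Metric.ball_subset_ball' (by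
      rw [dist_comm]; linarith [Metric.mem_ball.1 hxz]))
    rw [← enorm_neg, neg_sub] at h2
    have h3 := hwu x (subset_closure hxΩ)
    have h2' : ‖(⨍ y in Metric.ball x (2 * r), u y ∂ν) - ⨍ y in Metric.ball z r, u y ∂ν‖ₑ ≤
        A 0 x := by simpa only [A, pow_zero, mul_one] using h2
    refine le_trans ?_ (add_le_add (add_le_add h1 h2') h3)
    refine le_trans (le_of_eq ?_) ((enorm_add_le _ _).trans
      (add_le_add (enorm_add_le _ _) le_rfl))
    congr 1
    abel
  refine (laverage_mono_ae hpt).trans ?_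
  have hsumm : AEMeasurable (fun x => ∑ j ∈ Finset.range n, A j x)
      ((ν.restrict (Metric.ball z r) univ)⁻¹ • ν.restrict (Metric.ball z r)) :=
    Finset.aemeasurable_fun_sum _ fun j _ => hAm j
  have hsumm' : AEMeasurable (fun x => (∑ j ∈ Finset.range n, A j x) + A 0 x)
      ((ν.restrict (Metric.ball z r) univ)⁻¹ • ν.restrict (Metric.ball z r)) := hsumm.add (hAm 0)
  rw [laverage, lintegral_add_left' hsumm', lintegral_add_left' hsumm,
    lintegral_finsetSum' _ fun j _ => hAm j]
  refine add_le_add (le_trans (add_le_add (Finset.sum_le_sum fun j _ => hAC j) (hAC 0)) ?_) hwB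
  rw [← Finset.sum_mul, ← add_mul, ← Finset.mul_sum, ← mul_add]
  gcongr
  refine (add_le_add (sum_geometric_two_inv_le (by positivity) n) le_rfl).trans ?_
  rw [pow_zero, mul_one, ← ENNReal.ofReal_add (by positivity) (by positivity)]
  exact ENNReal.ofReal_le_ofReal (by linarith)

end Poincare

/-! ### Averages at the boundary -/

section Boundary

variable {X : Type*} [MetricSpace X] {Ω : Set X}

theorem diam_pos_of_mem_frontier (hΩ : IsOpen Ω) (hbdd : Bornology.IsBounded Ω) {x : X}
    (hx : x ∈ frontier Ω) : 0 < Metric.diam Ω := by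
  rw [hΩ.frontier_eq] at hx
  obtain ⟨y, hy, -⟩ := Metric.mem_closure_iff.1 hx.1 1 one_pos
  have hxy : 0 < dist x y := dist_pos.2 fun h => hx.2 (h ▸ hy)
  rw [← Metric.diam_closure]
  exact hxy.trans_le (Metric.dist_le_diam_of_mem hbdd.closure hx.1 (subset_closure hy))

variable [MeasurableSpace X] {μ H : Measure X} {p θ : ℝ} {D : ℝ≥0}

theorem isFiniteMeasure_restrict_of_doublingOn (hne : Ω.Nonempty) (hbdd : Bornology.IsBounded Ω)
    (h : DoublingOn Ω μ) : IsFiniteMeasure (μ.restrict Ω) := by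
  obtain ⟨C, -, h⟩ := h
  obtain ⟨x, hx⟩ := hne
  obtain ⟨r, hr0, hr⟩ := hbdd.subset_ball_lt 0 x
  refine ⟨?_⟩
  rw [Measure.restrict_apply_univ, ← inter_eq_right.2 hr]
  exact (h x (subset_closure hx) r hr0).2.2

variable [BorelSpace X]

theorem exists_doublingAt_of_doublingOn (h : DoublingOn Ω μ) :
    ∃ D, DoublingAt (closure Ω) (μ.restrict Ω) D := by
  obtain ⟨C, hC, h⟩ := h
  refine ⟨C, hC, fun x hx r hr => ?_, fun x hx r hr => ?_⟩
  · rw [Measure.restrict_apply Metric.isOpen_ball.measurableSet]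
    have := (h x hx (r / 2) (half_pos hr)).1
    rwa [mul_div_cancel₀ r two_ne_zero] at this
  · rw [Measure.restrict_apply Metric.isOpen_ball.measurableSet,
      Measure.restrict_apply Metric.isOpen_ball.measurableSet]
    exact (h x hx r hr).2.1

/-- The codimension bound on boundary balls, extended to all radii `s` at the price of measuring
with a smaller admissible radius `r`. -/
theorem exists_measure_frontier_ball_le (hΩ : IsOpen Ω) (hbdd : Bornology.IsBounded Ω)
    (hθ : 0 < θ) (h : UpperCodimRegular Ω μ (frontier Ω) H θ) :
    ∃ c : ℝ≥0, c ≠ 0 ∧ ∀ x ∈ frontier Ω, ∀ r s : ℝ, 0 < r → r ≤ 2 * Metric.diam Ω → r ≤ s →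
      H.restrict (frontier Ω) (Metric.ball x s) ≤
        c * (μ.restrict Ω (Metric.ball x s) / ENNReal.ofReal (r ^ θ)) := by
  obtain ⟨C, h⟩ := h
  refine ⟨C + 1, by positivity, fun x hx r s hr hrR hrs => ?_⟩
  have hd := diam_pos_of_mem_frontier hΩ hbdd hx
  set t := min s (2 * Metric.diam Ω) with ht
  have hrt : r ≤ t := le_min hrs hrR
  -- Balls of radius `2 * diam Ω` about boundary points cover the boundary.
  have hsub : Metric.ball x s ∩ frontier Ω ⊆ Metric.ball x t ∩ frontier Ω := by
    rintro y ⟨hys, hyF⟩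
    refine ⟨Metric.mem_ball.2 (lt_min hys ?_), hyF⟩
    have := Metric.dist_le_diam_of_mem hbdd.closure (frontier_subset_closure hyF)
      (frontier_subset_closure hx)
    rw [Metric.diam_closure] at this
    linarith
  rw [Measure.restrict_apply Metric.isOpen_ball.measurableSet,
    Measure.restrict_apply Metric.isOpen_ball.measurableSet]
  refine (measure_mono hsub).trans ((h x hx t (hr.trans_le hrt) (min_le_right _ _)).trans ?_)
  gcongr
  · exact_mod_cast (le_self_add : C ≤ C + 1)
  · exact min_le_left _ _

/-- Averaging over balls of radius `Lam * r` centred at the boundary, from `L¹(Ω)` to `L¹(∂Ω)`. -/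
theorem exists_lintegral_frontier_setLAverage_le [IsFiniteMeasure (μ.restrict Ω)]
    [SFinite (H.restrict (frontier Ω))] (hΩ : IsOpen Ω)
    (hbdd : Bornology.IsBounded Ω) (h : DoublingAt (closure Ω) (μ.restrict Ω) D)
    (hK : IsCompact (closure Ω)) (hθ : 0 < θ)
    (hH : UpperCodimRegular Ω μ (frontier Ω) H θ) :
    ∃ c : ℝ≥0, ∀ Lam : ℝ, 1 ≤ Lam → ∀ r : ℝ, 0 < r → r ≤ 2 * Metric.diam Ω →
      ∀ G : X → ℝ≥0∞, AEMeasurable G (μ.restrict Ω) →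
        ∫⁻ z in frontier Ω, ⨍⁻ y in Metric.ball z (Lam * r), G y ∂μ.restrict Ω ∂H ≤
          c * ENNReal.ofReal (r ^ (-θ)) * ∫⁻ y, G y ∂μ.restrict Ω := by
  obtain ⟨c, hc, hH⟩ := exists_measure_frontier_ball_le hΩ hbdd hθ hH
  refine ⟨c * D, fun Lam hLam r hr hrR G hG => ?_⟩
  have hη : H.restrict (frontier Ω) (frontier Ω)ᶜ = 0 := by
    rw [Measure.restrict_apply isClosed_frontier.measurableSet.compl, compl_inter_self,
      measure_empty]
  have hD : D ≠ 0 := (zero_lt_one.trans_le h.one_le).ne'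
  have hrθ : 0 < r ^ (-θ) := Real.rpow_pos_of_pos hr _
  have hrr : r ≤ Lam * r := le_mul_of_one_le_left hr.le hLam
  refine (lintegral_setLAverage_ball_le (k := c * D * (r ^ (-θ)).toNNReal)
    (hK.isSeparable.mono frontier_subset_closure) hη
    (mul_ne_zero (mul_ne_zero hc hD) (Real.toNNReal_pos.2 hrθ).ne') (fun x hx => ?_) hG).trans
    (le_of_eq ?_)
  · refine (hH x hx r (2 * (Lam * r)) hr hrR (by linarith)).trans ?_
    have h1 := h.le x (frontier_subset_closure hx) (Lam * r) (hr.trans_le hrr)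
    calc (c : ℝ≥0∞) * (μ.restrict Ω (Metric.ball x (2 * (Lam * r))) / ENNReal.ofReal (r ^ θ))
        ≤ c * (D * μ.restrict Ω (Metric.ball x (Lam * r)) / ENNReal.ofReal (r ^ θ)) := by
          gcongr
      _ = _ := by
          rw [Real.rpow_neg hr.le, ENNReal.div_eq_inv_mul,
            ← ENNReal.ofReal_inv_of_pos (Real.rpow_pos_of_pos hr _)]
          push_cast
          rw [ENNReal.ofReal]
          ring
  · push_cast
    rfl

/-- The sum over the scales `r = 2⁻ᵏ (2 diam Ω)` of the Poincaré bounds at boundary points has an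
`L^p`-norm bounded by that of the gradient. The sum over `k` converges geometrically, as
`θ < p`. -/
theorem exists_lpNorm_tsum_frontier_le [IsFiniteMeasure (μ.restrict Ω)]
    [SFinite (H.restrict (frontier Ω))] (hΩ : IsOpen Ω)
    (hbdd : Bornology.IsBounded Ω) (h : DoublingAt (closure Ω) (μ.restrict Ω) D)
    (hK : IsCompact (closure Ω)) (hθ : 0 < θ) (hp : 1 ≤ p) (hθp : θ < p)
    (hH : UpperCodimRegular Ω μ (frontier Ω) H θ) (hd : 0 < Metric.diam Ω) {Lam : ℝ}
    (hLam : 1 ≤ Lam) :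
    ∃ c : ℝ≥0, ∀ G : X → ℝ≥0∞, AEMeasurable G (μ.restrict Ω) →
      (∫⁻ z in frontier Ω, (∑' k : ℕ, ENNReal.ofReal (2⁻¹ ^ k * (2 * Metric.diam Ω)) *
        (⨍⁻ y in Metric.ball z (Lam * (2⁻¹ ^ k * (2 * Metric.diam Ω))), G y ∂μ.restrict Ω) ^
          (1 / p)) ^ p ∂H) ^ (1 / p) ≤
        c * (∫⁻ y, G y ∂μ.restrict Ω) ^ (1 / p) := by
  obtain ⟨c, hc⟩ := exists_lintegral_frontier_setLAverage_le hΩ hbdd h hK hθ hH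
  have hp0 : 0 < p := by linarith
  set R := 2 * Metric.diam Ω with hR
  have hR0 : 0 < R := by positivity
  set q : ℝ := 2⁻¹ ^ (1 - θ / p)
  have hq0 : 0 < q := Real.rpow_pos_of_pos (by norm_num) _
  have hq1 : q < 1 := Real.rpow_lt_one (by norm_num) (by norm_num)
    (by rw [sub_pos, div_lt_one hp0]; exact hθp)
  have hsum : ∑' k : ℕ, ENNReal.ofReal (q ^ k * R ^ (1 - θ / p)) ≠ ∞ :=
    ((summable_geometric_of_lt_one hq0.le hq1).mul_right _).tsum_ofReal_ne_top
  refine ⟨c ^ (1 / p) * (∑' k : ℕ, ENNReal.ofReal (q ^ k * R ^ (1 - θ / p))).toNNReal,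
    fun G hG => ?_⟩
  have hη : H.restrict (frontier Ω) (frontier Ω)ᶜ = 0 := by
    rw [Measure.restrict_apply isClosed_frontier.measurableSet.compl, compl_inter_self,
      measure_empty]
  have hmeas := fun s => aemeasurable_setLAverage_ball (ν := μ.restrict Ω)
    (hK.isSeparable.mono frontier_subset_closure) hη hG s
  refine (lintegral_rpow_tsum_le hp fun k => ((hmeas _).pow_const _).const_mul _).trans ?_
  have hterm : ∀ k : ℕ, (∫⁻ z in frontier Ω, (ENNReal.ofReal (2⁻¹ ^ k * R) *
      (⨍⁻ y in Metric.ball z (Lam * (2⁻¹ ^ k * R)), G y ∂μ.restrict Ω) ^ (1 / p)) ^ p ∂H) ^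
        (1 / p) ≤ c ^ (1 / p) * (∫⁻ y, G y ∂μ.restrict Ω) ^ (1 / p) *
          ENNReal.ofReal (q ^ k * R ^ (1 - θ / p)) := by
    intro k
    set r := (2 : ℝ)⁻¹ ^ k * R with hr
    have hr0 : 0 < r := by positivity
    have hrR : r ≤ R := mul_le_of_le_one_left hR0.le (pow_le_one₀ (by norm_num) (by norm_num))
    have hqr : q ^ k * R ^ (1 - θ / p) = r * (r ^ (-θ)) ^ (1 / p) := by
      rw [← Real.rpow_mul hr0.le, ← Real.rpow_one_add' hr0.le (by
        have : θ / p < 1 := by rw [div_lt_one hp0]; exact hθp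
        have h2 : -θ * (1 / p) = -(θ / p) := by ring
        rw [h2]; linarith), hr, Real.mul_rpow (by positivity) hR0.le, ← Real.rpow_natCast,
        ← Real.rpow_natCast, ← Real.rpow_mul (by norm_num), ← Real.rpow_mul (by norm_num)]
      ring_nf
    simp only [ENNReal.mul_rpow_of_nonneg _ _ hp0.le, ← ENNReal.rpow_mul,
      one_div_mul_cancel hp0.ne', ENNReal.rpow_one]
    rw [lintegral_const_mul'' _ (hmeas _), ENNReal.mul_rpow_of_nonneg _ _ (by positivity),
      ← ENNReal.rpow_mul, mul_one_div_cancel hp0.ne', ENNReal.rpow_one, hqr]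
    calc ENNReal.ofReal r * (∫⁻ z in frontier Ω,
          ⨍⁻ y in Metric.ball z (Lam * r), G y ∂μ.restrict Ω ∂H) ^ (1 / p)
        ≤ ENNReal.ofReal r * (c * ENNReal.ofReal (r ^ (-θ)) * ∫⁻ y, G y ∂μ.restrict Ω) ^
            (1 / p) := by
          gcongr
          exact hc Lam hLam r hr0 hrR G hG
      _ = _ := by
          rw [ENNReal.mul_rpow_of_nonneg _ _ (by positivity),
            ENNReal.mul_rpow_of_nonneg _ _ (by positivity), ENNReal.ofReal_mul hr0.le,
            ENNReal.ofReal_rpow_of_nonneg (by positivity) (by positivity)]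
          ring
  refine (ENNReal.tsum_le_tsum hterm).trans (le_of_eq ?_)
  rw [ENNReal.tsum_mul_left]
  push_cast
  rw [ENNReal.coe_toNNReal hsum, ENNReal.coe_rpow_of_nonneg _ (by positivity)]
  ring

end Boundary

/-! ### Existence of the trace -/

section Trace

variable {X : Type*} [MetricSpace X] [MeasurableSpace X] {K : Set X} {ν : Measure X} {D : ℝ≥0}

theorem DoublingAt.setLAverage_le [IsFiniteMeasure ν] (h : DoublingAt K ν D) {z : X} (hz : z ∈ K)
    {r s : ℝ} (hr : 0 < r) (hrs : r ≤ s) (hs : s ≤ 2 * r) (f : X → ℝ≥0∞) :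
    ⨍⁻ x in Metric.ball z r, f x ∂ν ≤ D * ⨍⁻ x in Metric.ball z s, f x ∂ν :=
  setLAverage_le_mul_setLAverage (Metric.ball_subset_ball hrs)
    ((measure_mono (Metric.ball_subset_ball hs)).trans (h.le z hz r hr)) f

theorem tendsto_setLAverage_ball_of_dyadic [IsFiniteMeasure ν] (h : DoublingAt K ν D) {z : X}
    (hz : z ∈ K) {R : ℝ} (hR : 0 < R) {f : X → ℝ≥0∞}
    (hf : Tendsto (fun k : ℕ => ⨍⁻ x in Metric.ball z (2⁻¹ ^ k * R), f x ∂ν) atTop (𝓝 0)) :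
    Tendsto (fun r : ℝ => ⨍⁻ x in Metric.ball z r, f x ∂ν) (𝓝[>] 0) (𝓝 0) := by
  have hD : Tendsto (fun k : ℕ => (D : ℝ≥0∞) * ⨍⁻ x in Metric.ball z (2⁻¹ ^ k * R), f x ∂ν)
      atTop (𝓝 0) := by
    simpa using ENNReal.Tendsto.const_mul hf (Or.inr ENNReal.coe_ne_top)
  rw [ENNReal.tendsto_nhds_zero] at hD ⊢
  intro ε hε
  obtain ⟨N, hN⟩ := eventually_atTop.1 (hD ε hε)
  filter_upwards [Ioo_mem_nhdsGT (show 0 < (2 : ℝ)⁻¹ ^ N * R by positivity)] with r hr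
  obtain ⟨hr0, hrN⟩ := hr
  have hNR : (2 : ℝ)⁻¹ ^ N * R ≤ R :=
    mul_le_of_le_one_left hR.le (pow_le_one₀ (by norm_num) (by norm_num))
  obtain ⟨n, hn1, hn2⟩ := exists_nat_pow_near_of_lt_one (div_pos hr0 hR)
    (by rw [div_le_one hR]; linarith) (show (0 : ℝ) < 2⁻¹ by norm_num) (by norm_num)
  rw [lt_div_iff₀ hR] at hn1
  rw [div_le_iff₀ hR] at hn2
  have hNn : N ≤ n := by
    by_contra! hcon
    have : (2 : ℝ)⁻¹ ^ N ≤ 2⁻¹ ^ (n + 1) :=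
      pow_le_pow_of_le_one (by norm_num) (by norm_num) hcon
    nlinarith
  refine (h.setLAverage_le hz hr0 hn2 ?_ f).trans (hN n hNn)
  rw [pow_succ] at hn1
  linarith

variable {V : Type*} [NormedAddCommGroup V] [NormedSpace ℝ V] [CompleteSpace V]

/-- If the mean oscillations over dyadic balls about `z` are summable, then the means converge,
and the limit is the trace at `z`. -/
theorem exists_trace_of_tsum_ne_top [IsFiniteMeasure ν] (h : DoublingAt K ν D) {z : X}
    (hz : z ∈ K) {R : ℝ} (hR : 0 < R) {u : X → V} (hu : Integrable u ν) {a : ℕ → ℝ≥0∞}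
    (ha : ∀ k : ℕ, ⨍⁻ x in Metric.ball z (2⁻¹ ^ k * R),
      ‖u x - ⨍ y in Metric.ball z (2⁻¹ ^ k * R), u y ∂ν‖ₑ ∂ν ≤ a k) (hsum : ∑' k, a k ≠ ∞) :
    ∃ v : V, Tendsto (fun k : ℕ => ⨍ x in Metric.ball z (2⁻¹ ^ k * R), u x ∂ν) atTop (𝓝 v) ∧
      Tendsto (fun r : ℝ => ⨍⁻ x in Metric.ball z r, edist (u x) v ∂ν) (𝓝[>] 0) (𝓝 0) ∧
      ‖v‖ₑ ≤ (⨍⁻ x in Metric.ball z R, ‖u x‖ₑ ∂ν) + D * ∑' k, a k := by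
  set m : ℕ → V := fun k => ⨍ x in Metric.ball z (2⁻¹ ^ k * R), u x ∂ν with hm
  have hdist : ∀ k, edist (m k) (m k.succ) ≤ D * a k := by
    intro k
    rw [edist_comm, edist_eq_enorm_sub]
    have hk : 0 < (2 : ℝ)⁻¹ ^ k * R := by positivity
    have hk' : (2 : ℝ)⁻¹ ^ k.succ * R = (2⁻¹ ^ k * R) / 2 := by rw [pow_succ]; ring
    refine (enorm_setAverage_sub_le (h.pos z hz _ (by positivity)).ne' hu _).trans ?_
    refine (h.setLAverage_le hz (s := 2⁻¹ ^ k * R) (by positivity) (by rw [hk']; linarith)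
      (by rw [hk']; linarith) _).trans ?_
    gcongr
    exact ha k
  have hsum' : ∑' k, D * a k ≠ ∞ := by
    rw [ENNReal.tsum_mul_left]
    exact ENNReal.mul_ne_top ENNReal.coe_ne_top hsum
  obtain ⟨v, hv⟩ := cauchySeq_tendsto_of_complete
    (cauchySeq_of_edist_le_of_tsum_ne_top _ hdist hsum')
  refine ⟨v, hv, tendsto_setLAverage_ball_of_dyadic h hz hR ?_, ?_⟩
  · have hlim : Tendsto (fun k => a k + edist (m k) v) atTop (𝓝 0) := by
      simpa using (ENNReal.tendsto_atTop_zero_of_tsum_ne_top hsum).add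
        (tendsto_iff_edist_tendsto_0.1 hv)
    refine tendsto_of_tendsto_of_tendsto_of_le_of_le tendsto_const_nhds hlim
      (fun k => zero_le) fun k => ?_
    refine le_trans (laverage_mono_ae (Eventually.of_forall fun x =>
      edist_triangle (u x) (m k) v)) ?_
    refine (setLAverage_add_const_le _ _).trans (add_le_add ?_ le_rfl)
    simp only [edist_eq_enorm_sub]
    exact ha k
  · have h0 := edist_le_tsum_of_edist_le_of_tendsto₀ _ hdist hv
    rw [ENNReal.tsum_mul_left] at h0
    have h1 : ‖m 0‖ₑ ≤ ⨍⁻ x in Metric.ball z R, ‖u x‖ₑ ∂ν := by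
      have := enorm_setAverage_sub_le (h.pos z hz R hR).ne' hu 0
      simpa [hm] using this
    refine le_trans ?_ (add_le_add h1 h0)
    rw [edist_comm, edist_eq_enorm_sub]
    refine le_trans (le_of_eq ?_) (enorm_add_le _ _)
    congr 1
    abel

end Trace

/-! ### Sobolev maps and their traces -/

section Newton

theorem eLpNorm_ofReal_eq {α V : Type*} [MeasurableSpace α] [NormedAddCommGroup V] {p : ℝ}
    (hp : 0 < p) (f : α → V) (ν : Measure α) :
    eLpNorm f (ENNReal.ofReal p) ν = (∫⁻ x, ‖f x‖ₑ ^ p ∂ν) ^ (1 / p) := by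
  rw [eLpNorm_eq_lintegral_rpow_enorm_toReal (ENNReal.ofReal_pos.2 hp).ne' ENNReal.ofReal_ne_top,
    ENNReal.toReal_ofReal hp.le]

variable {X : Type*} [MetricSpace X] [MeasurableSpace X] {Ω : Set X}
  {μ : Measure X} {p : ℝ}
  {V : Type*} [NormedAddCommGroup V] [NormedSpace ℝ V]

theorem exists_poincare [BorelSpace X] [CompleteSpace V] [IsFiniteMeasure (μ.restrict Ω)]
    (hp : 1 ≤ p) (hΩ : IsOpen Ω) {D : ℝ≥0} (h : DoublingAt (closure Ω) (μ.restrict Ω) D)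
    (hK : IsCompact (closure Ω)) (hP : LocalPoincare Ω μ p) :
    ∃ (C : ℝ≥0) (Lam : ℝ), 1 ≤ Lam ∧ ∀ u : X → V, Integrable u (μ.restrict Ω) →
      ∀ g : X → ℝ≥0∞, IsUpperGradient Ω g u → ∀ z ∈ closure Ω, ∀ r : ℝ, 0 < r →
        ⨍⁻ x in Metric.ball z r, ‖u x - ⨍ y in Metric.ball z r, u y ∂μ.restrict Ω‖ₑ
          ∂μ.restrict Ω ≤
        C * ENNReal.ofReal r *
          (⨍⁻ y in Metric.ball z (Lam * r), g y ^ p ∂μ.restrict Ω) ^ (1 / p) := by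
  obtain ⟨C₀, lam, hlam, hC₀⟩ := exists_nestedMeanBound (V := V) h hP
  obtain ⟨C, Lam, hLam, hC⟩ := exists_poincare_of_nestedMeanBound (V := V) hp hΩ h hK C₀ hlam
  exact ⟨C, Lam, hLam, fun u hu g hg => hC u hu g hg.1 (hC₀ u hu g hg)⟩

variable [BorelSpace X] [CompleteSpace X] [CompleteSpace V]

/-- Existence of the trace, with its norm estimate. The estimate is first proved with an upper
gradient in place of the Dirichlet seminorm; the limit of the means does not depend on it. -/
theorem exists_trace (hΩ : IsOpen Ω) (hne : Ω.Nonempty) (hbdd : Bornology.IsBounded Ω)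
    {H : Measure X} [SFinite (H.restrict (frontier Ω))] {θ : ℝ}
    (hadm : WeaklyAdmissible Ω μ H p θ) :
    ∃ C : ℝ≥0, ∀ u : X → V, MemLp u (ENNReal.ofReal p) (μ.restrict Ω) → gradNorm Ω μ p u < ∞ →
      ∃ τ : X → V, AEStronglyMeasurable τ (H.restrict (frontier Ω)) ∧
        (∀ᵐ z ∂H.restrict (frontier Ω), IsTraceAt Ω μ u z (τ z) ∧
          Tendsto (fun k : ℕ => ⨍ x in Metric.ball z (2⁻¹ ^ k * (2 * Metric.diam Ω)) ∩ Ω, u x ∂μ)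
            atTop (𝓝 (τ z))) ∧
        eLpNorm τ (ENNReal.ofReal p) (H.restrict (frontier Ω)) ≤
          C * (eLpNorm u (ENNReal.ofReal p) (μ.restrict Ω) + gradNorm Ω μ p u) := by
  rcases (frontier Ω).eq_empty_or_nonempty with hF | ⟨x₀, hx₀⟩
  · exact ⟨0, fun u _ _ => ⟨0, aestronglyMeasurable_zero, by simp [hF], by simp⟩⟩
  have hd := diam_pos_of_mem_frontier hΩ hbdd hx₀
  have hp : 1 ≤ p := hadm.one_lt.le
  have hp0 : 0 < p := by linarith
  have := isFiniteMeasure_restrict_of_doublingOn hne hbdd hadm.doubling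
  obtain ⟨D, hD⟩ := exists_doublingAt_of_doublingOn hadm.doubling
  have hK : IsCompact (closure Ω) :=
    (hD.totallyBounded hbdd.closure).isCompact_of_isClosed isClosed_closure
  obtain ⟨C₁, Lam, hLam, hC₁⟩ := exists_poincare (V := V) hp hΩ hD hK hadm.poincare
  obtain ⟨C₂, hC₂⟩ := exists_lpNorm_tsum_frontier_le hΩ hbdd hD hK hadm.pos hp hadm.lt
    hadm.upperCodim hd hLam
  obtain ⟨C₃, hC₃⟩ := exists_lintegral_frontier_setLAverage_le hΩ hbdd hD hK hadm.pos
    hadm.upperCodim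
  set ν := μ.restrict Ω
  set η := H.restrict (frontier Ω)
  set R := 2 * Metric.diam Ω with hR
  have hR0 : 0 < R := by positivity
  have hη : η (frontier Ω)ᶜ = 0 := by
    rw [Measure.restrict_apply isClosed_frontier.measurableSet.compl, compl_inter_self,
      measure_empty]
  have hsep := hK.isSeparable.mono (frontier_subset_closure (s := Ω))
  set C₄ : ℝ≥0 := (C₃ * (R ^ (-θ)).toNNReal) ^ (1 / p)
  refine ⟨max C₄ (D * C₁ * C₂), fun u hu hgrad => ?_⟩
  have hui : Integrable u ν := hu.integrable (ENNReal.one_le_ofReal.2 hp)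
  -- The mean over the largest ball, and the sum of the oscillations over all scales.
  set a : X → ℝ≥0∞ := fun z => (⨍⁻ x in Metric.ball z R, ‖u x‖ₑ ^ p ∂ν) ^ (1 / p)
  set S : (X → ℝ≥0∞) → X → ℝ≥0∞ := fun g z => ∑' k : ℕ, ENNReal.ofReal (2⁻¹ ^ k * R) *
    (⨍⁻ y in Metric.ball z (Lam * (2⁻¹ ^ k * R)), g y ^ p ∂ν) ^ (1 / p)
  have hum : AEMeasurable (fun x => ‖u x‖ₑ ^ p) ν := hu.1.enorm.pow_const p
  have ham : AEMeasurable a η := (aemeasurable_setLAverage_ball hsep hη hum R).pow_const _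
  have hSm : ∀ g : X → ℝ≥0∞, Measurable g → AEMeasurable (S g) η := fun g hg =>
    AEMeasurable.tsum fun k => ((aemeasurable_setLAverage_ball hsep hη
      (hg.pow_const p).aemeasurable _).pow_const _).const_mul _
  have ha : (∫⁻ z, a z ^ p ∂η) ^ (1 / p) ≤ C₄ * eLpNorm u (ENNReal.ofReal p) ν := by
    simp only [a, ← ENNReal.rpow_mul, one_div_mul_cancel hp0.ne', ENNReal.rpow_one]
    have h1 := hC₃ 1 le_rfl R hR0 le_rfl _ hum
    rw [one_mul] at h1
    refine (ENNReal.rpow_le_rpow h1 (by positivity)).trans (le_of_eq ?_)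
    rw [eLpNorm_ofReal_eq hp0, ENNReal.mul_rpow_of_nonneg _ _ (by positivity),
      ENNReal.coe_rpow_of_nonneg _ (by positivity)]
    push_cast
    rfl
  have hpt : ∀ g : X → ℝ≥0∞, IsUpperGradient Ω g u → ∀ z ∈ frontier Ω, S g z ≠ ∞ →
      ∃ v : V, Tendsto (fun k : ℕ => ⨍ x in Metric.ball z (2⁻¹ ^ k * R), u x ∂ν) atTop (𝓝 v) ∧
        Tendsto (fun r : ℝ => ⨍⁻ x in Metric.ball z r, edist (u x) v ∂ν) (𝓝[>] 0) (𝓝 0) ∧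
        ‖v‖ₑ ≤ a z + D * C₁ * S g z := by
    intro g hg z hz hS
    have hzK := frontier_subset_closure hz
    have hsum : ∑' k : ℕ, C₁ * ENNReal.ofReal (2⁻¹ ^ k * R) *
        (⨍⁻ y in Metric.ball z (Lam * (2⁻¹ ^ k * R)), g y ^ p ∂ν) ^ (1 / p) = C₁ * S g z := by
      simp only [mul_assoc, S]
      rw [ENNReal.tsum_mul_left]
    obtain ⟨v, hv1, hv2, hv3⟩ := exists_trace_of_tsum_ne_top hD hzK hR0 hui
      (fun k => hC₁ u hui g hg z hzK (2⁻¹ ^ k * R) (by positivity))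
      (by rw [hsum]; exact ENNReal.mul_ne_top ENNReal.coe_ne_top hS)
    refine ⟨v, hv1, hv2, hv3.trans ?_⟩
    rw [hsum, mul_assoc]
    refine add_le_add ?_ le_rfl
    have := setLAverage_rpow_le hp (hD.pos z hzK R hR0).ne' hum.restrict
    simpa only [← ENNReal.rpow_mul, mul_one_div_cancel hp0.ne', ENNReal.rpow_one] using this
  have hSg : ∀ g : X → ℝ≥0∞, IsUpperGradient Ω g u →
      (∫⁻ z, S g z ^ p ∂η) ^ (1 / p) ≤ C₂ * MetricTrace.lpNorm Ω μ p g := fun g hg =>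
    hC₂ _ (hg.1.pow_const p).aemeasurable
  have hSfin : ∀ g : X → ℝ≥0∞, IsUpperGradient Ω g u → MetricTrace.lpNorm Ω μ p g < ∞ →
      ∀ᵐ z ∂η, z ∈ frontier Ω ∧ S g z ≠ ∞ := by
    intro g hg hgt
    have hfin : (∫⁻ z, S g z ^ p ∂η) ≠ ∞ := by
      intro htop
      have h1 := hSg g hg
      rw [htop, ENNReal.top_rpow_of_pos (by positivity)] at h1
      exact (ENNReal.mul_lt_top ENNReal.coe_lt_top hgt).not_ge h1
    filter_upwards [mem_ae_iff.2 hη, ae_lt_top' ((hSm g hg.1).pow_const p) hfin] with z hz hz'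
    refine ⟨hz, fun htop => ?_⟩
    rw [htop, ENNReal.top_rpow_of_pos hp0] at hz'
    exact lt_irrefl _ hz'
  obtain ⟨g₀, hg₀, hg₀t⟩ := exists_isUpperGradient_of_gradNorm_lt hp hgrad
  obtain ⟨τ, hτm, hτ⟩ := exists_stronglyMeasurable_limit_of_tendsto_ae
    (f := fun (k : ℕ) (z : X) => ⨍ x in Metric.ball z (2⁻¹ ^ k * R), u x ∂ν) (μ := η)
    (fun k => aestronglyMeasurable_setAverage_ball hsep hη hu.1 _) (by
      filter_upwards [hSfin g₀ hg₀ hg₀t] with z hz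
      obtain ⟨v, hv, -⟩ := hpt g₀ hg₀ z hz.1 hz.2
      exact ⟨v, hv⟩)
  refine ⟨τ, hτm.aestronglyMeasurable, ?_, ?_⟩
  · filter_upwards [hSfin g₀ hg₀ hg₀t, hτ] with z hz hτz
    obtain ⟨v, hv1, hv2, -⟩ := hpt g₀ hg₀ z hz.1 hz.2
    rw [tendsto_nhds_unique hτz hv1] at *
    simp only [IsTraceAt, restrict_ball_inter]
    exact ⟨hv2, hv1⟩
  · have hbound : ∀ t, gradNorm Ω μ p u < t → t < ∞ → eLpNorm τ (ENNReal.ofReal p) η ≤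
        (max C₄ (D * C₁ * C₂) : ℝ≥0) * (eLpNorm u (ENNReal.ofReal p) ν + t) := by
      intro t ht htop
      obtain ⟨g, hg, hgt⟩ := exists_isUpperGradient_of_gradNorm_lt hp ht
      rw [eLpNorm_ofReal_eq hp0]
      calc (∫⁻ z, ‖τ z‖ₑ ^ p ∂η) ^ (1 / p)
          ≤ (∫⁻ z, (a + fun z => D * C₁ * S g z) z ^ p ∂η) ^ (1 / p) := by
            refine ENNReal.rpow_le_rpow (lintegral_mono_ae ?_) (by positivity)
            filter_upwards [hSfin g hg (hgt.trans htop), hτ] with z hz hτz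
            obtain ⟨v, hv1, -, hv3⟩ := hpt g hg z hz.1 hz.2
            rw [tendsto_nhds_unique hτz hv1]
            exact ENNReal.rpow_le_rpow hv3 hp0.le
        _ ≤ (∫⁻ z, a z ^ p ∂η) ^ (1 / p) + (∫⁻ z, (D * C₁ * S g z) ^ p ∂η) ^ (1 / p) :=
            ENNReal.lintegral_Lp_add_le ham ((hSm g hg.1).const_mul _) hp
        _ = (∫⁻ z, a z ^ p ∂η) ^ (1 / p) + D * C₁ * (∫⁻ z, S g z ^ p ∂η) ^ (1 / p) := by
            simp only [ENNReal.mul_rpow_of_nonneg _ _ hp0.le]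
            rw [lintegral_const_mul'' _ ((hSm g hg.1).pow_const p),
              ENNReal.mul_rpow_of_nonneg _ _ (by positivity),
              ← ENNReal.mul_rpow_of_nonneg _ _ hp0.le,
              ← ENNReal.rpow_mul, mul_one_div_cancel hp0.ne', ENNReal.rpow_one]
        _ ≤ C₄ * eLpNorm u (ENNReal.ofReal p) ν + D * C₁ * (C₂ * t) := by
            gcongr
            exact (hSg g hg).trans (by gcongr)
        _ = C₄ * eLpNorm u (ENNReal.ofReal p) ν + (D * C₁ * C₂ : ℝ≥0) * t := by
            push_cast; ring
        _ ≤ _ := by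
            rw [mul_add]
            gcongr
            · exact le_max_left _ _
            · exact le_max_right _ _
    have : (𝓝[>] gradNorm Ω μ p u).NeBot := nhdsGT_neBot_of_exists_gt ⟨∞, hgrad⟩
    have hlim : Tendsto (fun t => ((max C₄ (D * C₁ * C₂) : ℝ≥0) : ℝ≥0∞) *
        (eLpNorm u (ENNReal.ofReal p) ν + t)) (𝓝[>] gradNorm Ω μ p u)
        (𝓝 ((max C₄ (D * C₁ * C₂) : ℝ≥0) *
          (eLpNorm u (ENNReal.ofReal p) ν + gradNorm Ω μ p u))) :=
      ENNReal.Tendsto.const_mul ((tendsto_const_nhds.add tendsto_id).mono_left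
        nhdsWithin_le_nhds) (Or.inr ENNReal.coe_ne_top)
    refine ge_of_tendsto hlim ?_
    filter_upwards [Ioo_mem_nhdsGT hgrad] with t ht
    exact hbound t ht.1 ht.2

end Newton

/-! ### The trace operator -/

section Operator

variable {X : Type*} [MetricSpace X] [MeasurableSpace X] {Ω : Set X}
  {μ : Measure X} {p : ℝ} {V : Type*} [NormedAddCommGroup V]

variable {Y : Type*} [MetricSpace Y]

theorem measure_ball_inter_pos_lt_top (h : DoublingOn Ω μ) {z : X} (hz : z ∈ closure Ω) {r : ℝ}
    (hr : 0 < r) : 0 < μ (Metric.ball z r ∩ Ω) ∧ μ (Metric.ball z r ∩ Ω) < ∞ := by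
  obtain ⟨D, -, hD⟩ := h
  refine ⟨?_, (hD z hz r hr).2.2⟩
  simpa [mul_div_cancel₀] using (hD z hz (r / 2) (half_pos hr)).1

theorem Isometry.gradNorm_comp {h : Y → V} (hh : Isometry h) (u : X → Y) :
    gradNorm Ω μ p (h ∘ u) = gradNorm Ω μ p u := by
  simp only [gradNorm, IsWeakUpperGradient, UpperGradientIneq, Function.comp_apply, hh.edist_eq]

theorem MetricTrace.IsTraceAt.mem_range_of_isometry [CompleteSpace Y] {h : Y → V} (hh : Isometry h)
    {u : X → Y} {z : X} {v : V} (hv : IsTraceAt Ω μ (h ∘ u) z v)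
    (hpos : ∀ r : ℝ, 0 < r → 0 < μ (Metric.ball z r ∩ Ω) ∧ μ (Metric.ball z r ∩ Ω) < ∞) :
    v ∈ range h := by
  rw [← hh.isClosedEmbedding.isClosed_range.closure_eq, EMetric.mem_closure_iff]
  intro ε hε
  obtain ⟨δ, hδ0, hδε⟩ := exists_between hε
  have hlt := hv.eventually (gt_mem_nhds hδ0)
  obtain ⟨r, hr, hr0⟩ := (hlt.and self_mem_nhdsWithin).exists
  by_contra! hcon
  have hge : δ ≤ ⨍⁻ x in Metric.ball z r ∩ Ω, edist ((h ∘ u) x) v ∂μ := by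
    rw [← setLAverage_const (hpos r hr0).1.ne' (hpos r hr0).2.ne δ]
    refine laverage_mono_ae (Eventually.of_forall fun x => hδε.le.trans ?_)
    exact (hcon _ (mem_range_self (u x))).trans_eq (edist_comm _ _)
  exact hge.not_gt hr

variable [NormedSpace ℝ V]

theorem Isometry.comp_mem_newtonSubmodule [Fact (1 < p)] [IsFiniteMeasure (μ.restrict Ω)]
    {h : Y → V} (hh : Isometry h) {u : X → Y} (hu : MemNewton Ω μ p u) :
    h ∘ u ∈ newtonSubmodule Ω μ p V := by
  obtain ⟨⟨hm, y₀, hy₀⟩, hgrad⟩ := hu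
  refine ⟨?_, (hh.gradNorm_comp u).trans_lt hgrad⟩
  have hm' : AEStronglyMeasurable (h ∘ u) (μ.restrict Ω) :=
    hh.continuous.comp_aestronglyMeasurable hm
  have hsub : MemLp (fun x => (h ∘ u) x - h y₀) (ENNReal.ofReal p) (μ.restrict Ω) :=
    hy₀.of_le (hm'.sub aestronglyMeasurable_const) (Eventually.of_forall fun x => by
      rw [← dist_eq_norm, Function.comp_apply, hh.dist_eq, Real.norm_of_nonneg dist_nonneg])
  exact (hsub.add (memLp_const (h y₀))).ae_eq
    (Eventually.of_forall fun x => sub_add_cancel ((h ∘ u) x) (h y₀))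

/-- Traces of individual maps with a uniform bound make up a bounded linear operator: it is linear
because traces are limits of means. -/
theorem exists_traceOperator [Fact (1 < p)] [IsFiniteMeasure (μ.restrict Ω)] {H : Measure X}
    {R : ℝ} {C : ℝ≥0}
    (hC : ∀ u : X → V, MemLp u (ENNReal.ofReal p) (μ.restrict Ω) → gradNorm Ω μ p u < ∞ →
      ∃ τ : X → V, AEStronglyMeasurable τ (H.restrict (frontier Ω)) ∧
        (∀ᵐ z ∂H.restrict (frontier Ω), IsTraceAt Ω μ u z (τ z) ∧
          Tendsto (fun k : ℕ => ⨍ x in Metric.ball z (2⁻¹ ^ k * R) ∩ Ω, u x ∂μ)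
            atTop (𝓝 (τ z))) ∧
        eLpNorm τ (ENNReal.ofReal p) (H.restrict (frontier Ω)) ≤
          C * (eLpNorm u (ENNReal.ofReal p) (μ.restrict Ω) + gradNorm Ω μ p u)) :
    ∃ T : Newton Ω μ p V →L[ℝ] Lp V (ENNReal.ofReal p) (H.restrict (frontier Ω)),
      ∀ (u : X → V) (hu : u ∈ newtonSubmodule Ω μ p V), ∀ᵐ z ∂H.restrict (frontier Ω),
        IsTraceAt Ω μ u z (T (Newton.mk u hu) z) ∧
        Tendsto (fun k : ℕ => ⨍ x in Metric.ball z (2⁻¹ ^ k * R) ∩ Ω, u x ∂μ)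
          atTop (𝓝 (T (Newton.mk u hu) z)) := by
  have hp : 1 ≤ ENNReal.ofReal p := Fact.out
  choose! τ hτm hτ hτC using hC
  have hmem : ∀ u : PreNewton Ω μ p V,
      MemLp (τ u.toFun) (ENNReal.ofReal p) (H.restrict (frontier Ω)) := fun u =>
    ⟨hτm _ u.2.1 u.2.2, (hτC _ u.2.1 u.2.2).trans_lt
      (ENNReal.mul_lt_top ENNReal.coe_lt_top (ENNReal.add_lt_top.2 ⟨u.2.1.2, u.2.2⟩))⟩
  have hint : ∀ (u : PreNewton Ω μ p V) (s : Set X),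
      Integrable u.toFun ((μ.restrict (s ∩ Ω) univ)⁻¹ • μ.restrict (s ∩ Ω)) := fun u s =>
    ((u.2.1.integrable hp).mono_measure
      (Measure.restrict_mono inter_subset_right le_rfl)).to_average
  let L : PreNewton Ω μ p V →ₗ[ℝ] Lp V (ENNReal.ofReal p) (H.restrict (frontier Ω)) :=
    { toFun := fun u => (hmem u).toLp
      map_add' := fun u v => by
        rw [← MemLp.toLp_add, MemLp.toLp_eq_toLp_iff]
        filter_upwards [hτ _ u.2.1 u.2.2, hτ _ v.2.1 v.2.2, hτ _ (u + v).2.1 (u + v).2.2]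
          with z hu hv huv
        refine tendsto_nhds_unique huv.2 ((hu.2.add hv.2).congr fun k => ?_)
        exact (integral_add (hint u _) (hint v _)).symm
      map_smul' := fun c u => by
        rw [RingHom.id_apply, ← MemLp.toLp_const_smul, MemLp.toLp_eq_toLp_iff]
        filter_upwards [hτ _ u.2.1 u.2.2, hτ _ (c • u).2.1 (c • u).2.2] with z hu hcu
        refine tendsto_nhds_unique hcu.2 ((hu.2.const_smul c).congr fun k => ?_)
        exact (integral_smul c _).symm }
  have hL : ∀ u, ‖L u‖ ≤ C * ‖u‖ := by
    intro u
    have h1 := ENNReal.toReal_mono (ENNReal.mul_ne_top ENNReal.coe_ne_top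
      (ENNReal.add_ne_top.2 ⟨u.2.1.2.ne, u.2.2.ne⟩)) (hτC _ u.2.1 u.2.2)
    rw [ENNReal.toReal_mul, ENNReal.toReal_add u.2.1.2.ne u.2.2.ne] at h1
    rw [PreNewton.norm_def]
    exact (Lp.norm_toLp _ (hmem u)).trans_le h1
  let L' := L.mkContinuous C hL
  refine ⟨SeparationQuotient.liftCLM L' fun u v huv => (huv.map L'.continuous).eq,
    fun u hu => ?_⟩
  have hcoe : SeparationQuotient.liftCLM L' (fun u v huv => (huv.map L'.continuous).eq)
      (Newton.mk u hu) = (hmem ⟨u, hu⟩).toLp := rfl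
  rw [hcoe]
  filter_upwards [hτ u hu.1 hu.2, (hmem ⟨u, hu⟩).coeFn_toLp] with z hz hz'
  rw [hz']
  exact hz

end Operator

theorem theorem1p2 {X : Type*} [MetricSpace X] [CompleteSpace X] [MeasurableSpace X] [BorelSpace X]
    (Ω : Set X) (hΩ_open : IsOpen Ω) (hΩ_conn : IsConnected Ω) (hΩ_bdd : Bornology.IsBounded Ω)
    (μ H : Measure X) [SigmaFinite (H.restrict (frontier Ω))]
    (p θ : ℝ) [Fact (1 < p)] (hadm : WeaklyAdmissible Ω μ H p θ)
    (V : Type*) [NormedAddCommGroup V] [NormedSpace ℝ V] [CompleteSpace V] :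
    ∃ T : Newton Ω μ p V →L[ℝ] Lp V (ENNReal.ofReal p) (H.restrict (frontier Ω)),
      (∀ (u : X → V) (hu : u ∈ newtonSubmodule Ω μ p V),
        ∀ᵐ z ∂H.restrict (frontier Ω),
          IsTraceAt Ω μ u z (T (Newton.mk u hu) z) ∧
          Tendsto
            (fun k : ℕ => ⨍ x in Metric.ball z (2⁻¹ ^ k * (2 * Metric.diam Ω)) ∩ Ω, u x ∂μ)
            atTop (𝓝 (T (Newton.mk u hu) z))) ∧
      ∃ C : ℝ≥0, ∀ (Y : Type*) [MetricSpace Y] [CompleteSpace Y] (h : Y → V), Isometry h →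
        ∀ u : X → Y, MemNewton Ω μ p u →
          ∃ (hu : h ∘ u ∈ newtonSubmodule Ω μ p V) (τ : X → Y),
            MemLpMetric (frontier Ω) H p τ ∧
            (∀ᵐ z ∂H.restrict (frontier Ω),
              IsTraceAt Ω μ u z (τ z) ∧ h (τ z) = T (Newton.mk (h ∘ u) hu) z) ∧
            ∀ y₀ : Y,
              eLpNorm (fun z => dist (τ z) y₀) (ENNReal.ofReal p) (H.restrict (frontier Ω)) ≤
                C * (eLpNorm (fun x => dist (u x) y₀) (ENNReal.ofReal p) (μ.restrict Ω) +
                  gradNorm Ω μ p u) := by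
  have := isFiniteMeasure_restrict_of_doublingOn hΩ_conn.nonempty hΩ_bdd hadm.doubling
  obtain ⟨C, hC⟩ := exists_trace (V := V) hΩ_open hΩ_conn.nonempty hΩ_bdd hadm
  obtain ⟨T, hT⟩ := exists_traceOperator hC
  refine ⟨T, hT, ‖T‖₊, fun Y _ _ h hh u hu => ?_⟩
  have hw : h ∘ u ∈ newtonSubmodule Ω μ p V := hh.comp_mem_newtonSubmodule hu
  have : Nonempty Y := hΩ_conn.nonempty.elim fun x _ => ⟨u x⟩
  set w := T (Newton.mk (h ∘ u) hw)
  set τ : X → Y := fun z => Function.invFun h (w z)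
  have hF : ∀ᵐ z ∂H.restrict (frontier Ω), z ∈ frontier Ω :=
    ae_restrict_mem isClosed_frontier.measurableSet
  have hτ : ∀ᵐ z ∂H.restrict (frontier Ω), h (τ z) = w z := by
    filter_upwards [hT _ hw, hF] with z hz hzF
    have hz1 : IsTraceAt Ω μ (h ∘ u) z (w z) := hz.1
    exact Function.invFun_eq (hz1.mem_range_of_isometry hh fun r hr =>
      measure_ball_inter_pos_lt_top hadm.doubling (frontier_subset_closure hzF) hr)
  have hτm : AEStronglyMeasurable τ (H.restrict (frontier Ω)) := by
    rw [← hh.isEmbedding.aestronglyMeasurable_comp_iff]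
    exact (Lp.aestronglyMeasurable w).congr (hτ.mono fun z hz => hz.symm)
  have hbound : ∀ y₀ : Y,
      eLpNorm (fun z => dist (τ z) y₀) (ENNReal.ofReal p) (H.restrict (frontier Ω)) ≤
        ‖T‖₊ * (eLpNorm (fun x => dist (u x) y₀) (ENNReal.ofReal p) (μ.restrict Ω) +
          gradNorm Ω μ p u) := by
    intro y₀
    -- Apply the bound for `T` to the isometric embedding that sends `y₀` to the origin.
    have hk : Isometry fun y => h y - h y₀ := (IsometryEquiv.subRight (h y₀)).isometry.comp hh
    have hv : (fun y => h y - h y₀) ∘ u ∈ newtonSubmodule Ω μ p V :=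
      hk.comp_mem_newtonSubmodule hu
    set v := T (Newton.mk _ hv)
    have hvτ : ∀ᵐ z ∂H.restrict (frontier Ω), ‖dist (τ z) y₀‖ = ‖v z‖ := by
      filter_upwards [hT _ hv, hT _ hw, hτ, hF] with z hzv hzw hzτ hzF
      have hvw : v z = w z - h y₀ := by
        refine tendsto_nhds_unique hzv.2 ((hzw.2.sub_const (h y₀)).congr fun k => ?_)
        have hr : 0 < (2 : ℝ)⁻¹ ^ k * (2 * Metric.diam Ω) :=
          mul_pos (by positivity) (mul_pos two_pos (diam_pos_of_mem_frontier hΩ_open hΩ_bdd hzF))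
        have hpos := measure_ball_inter_pos_lt_top hadm.doubling
          (frontier_subset_closure hzF) hr
        have hint : IntegrableOn (h ∘ u) (Metric.ball z (2⁻¹ ^ k * (2 * Metric.diam Ω)) ∩ Ω) μ :=
          (hw.1.integrable Fact.out).mono_measure
            (Measure.restrict_mono inter_subset_right le_rfl)
        have hconst : IntegrableOn (fun _ => h y₀)
            (Metric.ball z (2⁻¹ ^ k * (2 * Metric.diam Ω)) ∩ Ω) μ :=
          integrableOn_const hpos.2.ne
        conv_lhs => rw [← setAverage_const hpos.1.ne' hpos.2.ne (h y₀)]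
        exact (integral_sub hint.to_average hconst.to_average).symm
      rw [hvw, ← hzτ, ← dist_eq_norm, hh.dist_eq, Real.norm_of_nonneg dist_nonneg]
    have hu₀ : eLpNorm ((fun y => h y - h y₀) ∘ u) (ENNReal.ofReal p) (μ.restrict Ω) =
        eLpNorm (fun x => dist (u x) y₀) (ENNReal.ofReal p) (μ.restrict Ω) :=
      eLpNorm_congr_norm_ae (Eventually.of_forall fun x => by
        rw [Function.comp_apply, ← dist_eq_norm, hh.dist_eq, Real.norm_of_nonneg dist_nonneg])
    have hnorm : ‖Newton.mk _ hv‖ₑ =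
        eLpNorm ((fun y => h y - h y₀) ∘ u) (ENNReal.ofReal p) (μ.restrict Ω) +
          gradNorm Ω μ p ((fun y => h y - h y₀) ∘ u) := by
      rw [← ENNReal.toReal_eq_toReal_iff' enorm_ne_top
        (ENNReal.add_ne_top.2 ⟨hv.1.2.ne, hv.2.ne⟩), ENNReal.toReal_add hv.1.2.ne hv.2.ne,
        toReal_enorm]
      rfl
    rw [eLpNorm_congr_norm_ae hvτ, ← Lp.enorm_def, ← hu₀, ← hk.gradNorm_comp u, ← hnorm]
    exact T.le_opENorm _
  refine ⟨hw, τ, ⟨hτm, ?_⟩, ?_, hbound⟩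
  · obtain ⟨⟨-, y₀, hy₀⟩, hgrad⟩ := hu
    refine ⟨y₀, ?_, (hbound y₀).trans_lt
      (ENNReal.mul_lt_top ENNReal.coe_lt_top (ENNReal.add_lt_top.2 ⟨hy₀.2, hgrad⟩))⟩
    exact (continuous_id.dist continuous_const).comp_aestronglyMeasurable hτm
  · filter_upwards [hT _ hw, hτ] with z hz hzτ
    refine ⟨?_, hzτ⟩
    have h1 := hz.1
    change IsTraceAt Ω μ (h ∘ u) z (w z) at h1
    rw [← hzτ] at h1
    simpa only [IsTraceAt, Function.comp_apply, hh.edist_eq] using h1
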